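/- Let $0<\alpha<1$. Consider a system of particles in $\mathbb R$ whose initial positions are the points of a homogeneous Poisson random measure with intensity the Lebesgue measure. There is no branching: the particles move independently of each other and of the initial configuration, each according to the standard symmetric $\alpha$-stable Lévy motion (characteristic function $x\mapsto e^{-t|x|^\alpha}$ at time $t$). Let $N_s$ be the empirical measure at time $s$, so that $N_s(A)$ is the number of particles in $A\subset\mathbb R$ at time $s$, and for $T>0$ let $$Y_T(t)=\frac1{\sqrt T}\left(\int_0^{Tt}N_s\,ds-\int_0^{Tt}E N_s\,ds\right).$$ Let $(\psi_t)_{t\ge 0}$ be any family of bounded, piecewise continuous (that is, continuous off a finite set) functions $\psi_t:\mathbb R\to\mathbb R$ with compact support, and write $\langle\mu,\psi\rangle=\int\psi\,d\mu$ and $\hat\psi(x)=\int_{\mathbb R}e^{ixy}\psi(y)\,dy$. Then the integrals defining $\langle Y_T(1),\psi_t\rangle$ exist almost surely, the integrals in the covariance below converge absolutely, and, as $T\to\infty$, the processes $(\langle Y_T(1),\psi_t\rangle)_{t\ge0}$ converge, in the sense of weak convergence of finite-dimensional distributions, to a centered Gaussian process $(\vartheta_t)_{t\ge0}$ with covariance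 $$E\,\vartheta_t\vartheta_s=\frac1\pi\int_{\mathbb R}\hat\psi_t(x)\,\overline{\hat\psi_s(x)}\,\frac1{|x|^\alpha}\,dx,\qquad s,t\ge0.$$ -/

import Mathlib

open MeasureTheory ProbabilityTheory Filter
open scoped NNReal ENNReal Topology

/-- The law of a *standard symmetric `α`-stable Lévy motion* on `ℝ`: it starts at `0`, has
independent increments, the increment over `[s, t]` has characteristic function
`x ↦ exp (-(t - s) |x| ^ α)`, and almost all paths are right continuous with left limits. -/
structure IsStableLevyMotion {Ω : Type*} [MeasurableSpace Ω] (α : ℝ) (X : ℝ≥0 → Ω → ℝ)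
    (P : Measure Ω) : Prop where
  measurable : ∀ t, Measurable (X t)
  start_zero : ∀ᵐ ω ∂P, X 0 ω = 0
  indep_increments : HasIndepIncrements X P
  charFun_increment : ∀ s t : ℝ≥0, s ≤ t → ∀ x : ℝ,
    charFun (P.map (fun ω ↦ X t ω - X s ω)) x =
      Complex.exp (((-(((t : ℝ) - (s : ℝ)) * |x| ^ α) : ℝ) : ℂ))
  cadlag : ∀ᵐ ω ∂P, ∀ t : ℝ≥0,
    ContinuousWithinAt (fun s ↦ X s ω) (Set.Ici t) t ∧
      ∃ l : ℝ, Tendsto (fun s ↦ X s ω) (𝓝[<] t) (𝓝 l)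

/-- `ν` is a *Poisson random measure* on `E` with intensity measure `μ`: the mass of a measurable
set of finite intensity is Poisson distributed with parameter the intensity of the set, and the
masses of finitely many pairwise disjoint measurable sets are independent. -/
structure IsPoissonRandomMeasure {Ω E : Type*} [MeasurableSpace Ω] [MeasurableSpace E]
    (ν : Ω → Measure E) (μ : Measure E) (P : Measure Ω) : Prop where
  measurable : ∀ A : Set E, MeasurableSet A → Measurable (fun ω ↦ ν ω A)
  hasLaw : ∀ A : Set E, MeasurableSet A → μ A ≠ ∞ →
    HasLaw (fun ω ↦ ν ω A)
      ((poissonMeasure (μ A).toNNReal).map (fun n : ℕ ↦ (n : ℝ≥0∞))) P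
  indep : ∀ (n : ℕ) (A : Fin n → Set E), (∀ i, MeasurableSet (A i)) →
    Pairwise (fun i j ↦ Disjoint (A i) (A j)) →
    iIndepFun (fun i ω ↦ ν ω (A i)) P

/-- The empirical measure `N_s` at time `s` of the particles that start at the points `x i` and
whose displacements are the processes `Z i`; `N_s A` is the number of particles in `A`. -/
noncomputable def empiricalMeasure {Ω : Type*} (x : ℕ → Ω → ℝ) (Z : ℕ → ℝ≥0 → Ω → ℝ)
    (s : ℝ≥0) (ω : Ω) : Measure ℝ :=
  Measure.sum (fun i ↦ Measure.dirac (x i ω + Z i s ω))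

/-- The non-branching particle system whose initial configuration is a homogeneous Poisson random
measure with intensity the Lebesgue measure, and whose particles move, independently of each other
and of the initial configuration, according to standard symmetric `α`-stable Lévy motions.
(The points of the initial configuration are numbered by `ℕ`: there are almost surely countably
infinitely many of them.) -/
structure IsPoissonStableSystem {Ω : Type*} [MeasurableSpace Ω] (α : ℝ)
    (x : ℕ → Ω → ℝ) (Z : ℕ → ℝ≥0 → Ω → ℝ) (P : Measure Ω) : Prop where
  measurable_start : ∀ i, Measurable (x i)
  poisson_start : IsPoissonRandomMeasure
    (fun ω ↦ Measure.sum (fun i ↦ Measure.dirac (x i ω))) (volume : Measure ℝ) P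
  stable_motion : ∀ i, IsStableLevyMotion α (Z i) P
  indep_motions : iIndepFun (fun i ω ↦ fun s ↦ Z i s ω) P
  indep_start_motions : IndepFun (fun ω ↦ fun i ↦ x i ω) (fun ω ↦ fun i s ↦ Z i s ω) P

/-- The pairing `⟨N_s, ψ⟩ = ∫ ψ dN_s` of a random-measure-valued process with a test function;
the time is a real number that is only used when it is nonnegative. -/
noncomputable def pairing {Ω : Type*} (N : ℝ≥0 → Ω → Measure ℝ) (ψ : ℝ → ℝ) (s : ℝ) (ω : Ω) : ℝ :=
  ∫ y, ψ y ∂(N s.toNNReal ω)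

/-- The pairing `⟨Y_T(t), ψ⟩` of a test function with the normalised occupation time fluctuation
`Y_T(t) = F_T⁻¹ (∫_0^{Tt} N_s ds - ∫_0^{Tt} E N_s ds)`. -/
noncomputable def occupationFluctuation {Ω : Type*} [MeasurableSpace Ω] (P : Measure Ω)
    (N : ℝ≥0 → Ω → Measure ℝ) (F : ℝ → ℝ) (T t : ℝ) (ψ : ℝ → ℝ) (ω : Ω) : ℝ :=
  (1 / F T) * ((∫ s in (0 : ℝ)..(T * t), pairing N ψ s ω) -
    ∫ s in (0 : ℝ)..(T * t), ∫ ω', pairing N ψ s ω' ∂P)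

/-- All integrals in the definition of `⟨Y_T(t), ψ⟩`, over times up to any horizon `R`, exist. -/
def OccupationIntegrable {Ω : Type*} [MeasurableSpace Ω] (P : Measure Ω)
    (N : ℝ≥0 → Ω → Measure ℝ) (ψ : ℝ → ℝ) : Prop :=
  (∀ s : ℝ, 0 ≤ s → (∀ᵐ ω ∂P, Integrable ψ (N s.toNNReal ω)) ∧ Integrable (pairing N ψ s) P) ∧
  ∀ R : ℝ, 0 ≤ R →
    IntervalIntegrable (fun s ↦ ∫ ω, pairing N ψ s ω ∂P) volume 0 R ∧
    ∀ᵐ ω ∂P, (∀ᵐ s ∂(volume.restrict (Set.Icc 0 R)), Integrable ψ (N s.toNNReal ω)) ∧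
      IntervalIntegrable (fun s ↦ pairing N ψ s ω) volume 0 R

/-- The class of bounded piecewise continuous functions with compact support. A function is
piecewise continuous here if it is continuous off a finite set; neither the values nor the existence
of one-sided limits at the exceptional points is restricted. -/
structure IsPiecewiseContinuousTest (ψ : ℝ → ℝ) : Prop where
  bounded : ∃ C : ℝ, ∀ y, |ψ y| ≤ C
  piecewise_continuous : ∃ D : Set ℝ, D.Finite ∧ ∀ y, y ∉ D → ContinuousAt ψ y
  compact_support : HasCompactSupport ψ

/-- The Fourier transform `ψ̂(x) = ∫ e^{ixy} ψ(y) dy`. -/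
noncomputable def fourierHat (ψ : ℝ → ℝ) (x : ℝ) : ℂ :=
  ∫ y : ℝ, Complex.exp (Complex.I * (x : ℂ) * (y : ℂ)) * (ψ y : ℂ)

/-- The function `ψ̂(x) conj(φ̂(x)) / |x|^α`. -/
noncomputable def covarianceIntegrand (α : ℝ) (ψ φ : ℝ → ℝ) (x : ℝ) : ℂ :=
  fourierHat ψ x * (starRingEnd ℂ) (fourierHat φ x) * ((1 / |x| ^ α : ℝ) : ℂ)

/-- Weak convergence, as `T → ∞`, of the finite dimensional distributions of the processes
`(X T t)_{t ≥ 0}` to those of `ϑ`. -/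
def FiniteDimTendsto {Ω Ω' : Type*} [MeasurableSpace Ω] [MeasurableSpace Ω']
    (X : ℝ → ℝ≥0 → Ω → ℝ) (P : Measure Ω) [IsProbabilityMeasure P]
    (ϑ : ℝ≥0 → Ω' → ℝ) (P' : Measure Ω') [IsProbabilityMeasure P'] : Prop :=
  ∀ I : Finset ℝ≥0, TendstoInDistribution (fun (T : ℝ) (ω : Ω) ↦ I.restrict (X T · ω)) atTop
    (fun ω ↦ I.restrict (ϑ · ω)) (fun _ ↦ P) P'

/-!
The fluctuation `⟨Y_T(1), ψ⟩` is `T^{-1/2}` times the centered sum, over the particles, of the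
occupation times `∫_0^T ψ(x_i + Z_i(s)) ds`. The starting points marked by the paths form a Poisson
process on `ℝ × (path space)` with intensity `dx ⊗ Q`, where `Q` is the law of the stable motion, so
that the characteristic function of the sum of `F` over the particles is
`exp ∫ (e^{iF} - 1)` (`IsMarkedPoisson.integral_exp_tsum`), and Campbell's formula yields the
existence of the integrals and the centering. Linear combinations of test functions are test
functions, hence, by Lévy's continuity theorem, it suffices to find the limit of
`∫ (e^{iF} - 1 - iF)` for `F` the occupation time of one `ψ` divided by `√T`.

The second moment `∫ F²` converges: Lebesgue measure is invariant for the motion, the identity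
`∫ E[ψ(y) ψ(y + Z(u))] dy = (2π)⁻¹ ∫ |ψ̂(x)|² e^{-u|x|^α} dx` is Plancherel's theorem, and the time
integral of this over `u ≥ 0` is finite since `|x|^{-α}` is integrable at `0` for `α < 1`
(`tendsto_integral_sq_occupationTime`). The third absolute moment of the occupation time is `O(T)`:
`ψ` is dominated by a multiple of `exp(-y²/2)`, the characteristic function of the standard Gaussian
law `γ`, so that `E exp(-(a + Z(u))²/2) ≤ ∫ e^{-u|x|^α} dγ(x)` uniformly in `a`. This bound is
integrable in `u` for the same reason, and the Markov property at the middle one of three times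
reduces the third moment to it (`lintegral_enorm_occupationTime_pow_three_le`). Thus `∫ |F|³ → 0`,
and only the second order term of the exponential contributes to the limit
(`tendsto_integral_exp_occupationTime`).

The limit process is the isonormal Gaussian process over `L²(ℝ; ℂ)` evaluated at the functions
`ψ̂_t(x) (π |x|^α)^{-1/2}`, whose inner products are the prescribed covariances
(`exists_gaussianProcess`, `inner_toLp_spectralFunction`).
-/

/-! ### The Fourier transform of square-integrable functions -/

open FourierTransform in
theorem continuous_fourier_of_integrable {f : ℝ → ℂ} (hf : Integrable f) : Continuous (𝓕 f) :=
  VectorFourier.fourierIntegral_continuous Real.continuous_fourierChar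
    (by exact continuous_inner) hf

open FourierTransform in
/-- For `f ∈ L¹ ∩ L²` the Fourier integral agrees with the `L²`-Fourier transform: both represent
the Fourier transform of `f` as a tempered distribution. -/
theorem fourier_toLp_ae_eq {f : ℝ → ℂ} (hf : Integrable f) (hf2 : MemLp f 2) :
    ((𝓕 (hf2.toLp f) : Lp (α := ℝ) ℂ 2 volume) : ℝ → ℂ) =ᵐ[volume] 𝓕 f := by
  refine ae_eq_of_integral_contDiff_smul_eq
    ((Lp.memLp (𝓕 (hf2.toLp f) : Lp (α := ℝ) ℂ 2 volume)).locallyIntegrable (by norm_num)) ?_ ?_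
  · exact (continuous_fourier_of_integrable hf).locallyIntegrable
  · intro g hg hgc
    have hg₁ : HasCompactSupport (Complex.ofRealCLM ∘ g) := hgc.comp_left rfl
    have hg₂ : ContDiff ℝ (⊤ : ℕ∞) (Complex.ofRealCLM ∘ g) := by fun_prop
    set G := hg₁.toSchwartzMap hg₂ with hG
    have hGg : ∀ y, G y = (g y : ℂ) := fun y ↦ rfl
    have h1 : ∫ y, G y • (𝓕 (hf2.toLp f) : Lp (α := ℝ) ℂ 2 volume) y =
        ∫ y, (𝓕 G) y • f y := by
      have h := Lp.fourier_toTemperedDistribution_eq (hf2.toLp f)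
      have h' := DFunLike.congr_fun h G
      rw [TemperedDistribution.fourier_apply, Lp.toTemperedDistribution_apply,
        Lp.toTemperedDistribution_apply] at h'
      rw [← h']
      refine integral_congr_ae ?_
      filter_upwards [hf2.coeFn_toLp] with y hy
      rw [hy]
    have h2 : ∫ y, (𝓕 (G : ℝ → ℂ)) y • f y = ∫ y, G y • (𝓕 f) y := by
      simpa using! (VectorFourier.integral_fourierIntegral_smul_eq_flip (L := innerₗ ℝ)
        Real.continuous_fourierChar continuous_inner G.integrable hf)
    have h3 := h1.trans ((by rw [SchwartzMap.fourier_coe] : _ = _).trans h2)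
    simpa [hGg] using h3

open FourierTransform in
theorem memLp_two_fourier {f : ℝ → ℂ} (hf : Integrable f) (hf2 : MemLp f 2) :
    MemLp (𝓕 f) 2 :=
  (memLp_congr_ae (fourier_toLp_ae_eq hf hf2)).1 (Lp.memLp _)

open FourierTransform in
/-- **Parseval's identity** for functions in `L¹ ∩ L²`. -/
theorem integral_fourier_mul_conj_fourier {f g : ℝ → ℂ} (hf : Integrable f) (hf2 : MemLp f 2)
    (hg : Integrable g) (hg2 : MemLp g 2) :
    ∫ y, (𝓕 f) y * (starRingEnd ℂ) ((𝓕 g) y) = ∫ y, f y * (starRingEnd ℂ) (g y) := by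
  have h := Lp.inner_fourier_eq (hg2.toLp g) (hf2.toLp f)
  rw [L2.inner_def, L2.inner_def] at h
  refine Eq.trans (Eq.trans (integral_congr_ae ?_) h) (integral_congr_ae ?_)
  · filter_upwards [fourier_toLp_ae_eq hf hf2, fourier_toLp_ae_eq hg hg2] with y h1 h2
    rw [h1, h2, RCLike.inner_apply]
  · filter_upwards [hf2.coeFn_toLp, hg2.coeFn_toLp] with y h1 h2
    rw [h1, h2, RCLike.inner_apply]

section FourierHat

variable {ψ φ : ℝ → ℝ}

open FourierTransform in
theorem fourierHat_eq_fourier (ψ : ℝ → ℝ) (x : ℝ) :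
    fourierHat ψ x = (𝓕 (fun y ↦ (ψ y : ℂ))) (-(2 * Real.pi)⁻¹ * x) := by
  rw [Real.fourier_eq', fourierHat]
  congr 1 with y
  simp only [RCLike.inner_apply, conj_trivial, smul_eq_mul]
  congr 2
  push_cast
  field_simp

theorem norm_fourierHat_le (ψ : ℝ → ℝ) (x : ℝ) : ‖fourierHat ψ x‖ ≤ ∫ y, |ψ y| := by
  refine (norm_integral_le_integral_norm _).trans (le_of_eq ?_)
  congr 1 with y
  rw [norm_mul, show Complex.I * (x : ℂ) * y = ((x * y : ℝ) : ℂ) * Complex.I by push_cast; ring,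
    Complex.norm_exp_ofReal_mul_I, one_mul, Complex.norm_real, Real.norm_eq_abs]

theorem continuous_fourierHat (hψ : Integrable ψ) : Continuous (fourierHat ψ) := by
  have h := (continuous_fourier_of_integrable (hψ.ofReal (𝕜 := ℂ))).comp
    (continuous_const_mul (-(2 * Real.pi)⁻¹))
  exact h.congr fun x ↦ (fourierHat_eq_fourier ψ x).symm

theorem fourierHat_neg (ψ : ℝ → ℝ) (x : ℝ) :
    fourierHat ψ (-x) = (starRingEnd ℂ) (fourierHat ψ x) := by
  rw [fourierHat, fourierHat, ← integral_conj]
  congr 1 with y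
  rw [map_mul, ← Complex.exp_conj]
  simp

theorem fourierHat_comp_add (ψ : ℝ → ℝ) (a x : ℝ) :
    fourierHat (fun y ↦ ψ (y + a)) x =
      Complex.exp (-(Complex.I * (x : ℂ) * (a : ℂ))) * fourierHat ψ x := by
  rw [fourierHat, fourierHat, ← integral_const_mul, ← integral_add_right_eq_self
    (fun y : ℝ ↦ Complex.exp (-(Complex.I * x * a)) * (Complex.exp (Complex.I * x * y) * ψ y)) a]
  congr 1 with y
  rw [← mul_assoc, ← Complex.exp_add]
  congr 2
  push_cast
  ring

theorem fourierHat_sum_mul {ι : Type*} (s : Finset ι) (a : ι → ℝ) (ψ : ι → ℝ → ℝ)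
    (hψ : ∀ i ∈ s, Integrable (ψ i)) (x : ℝ) :
    fourierHat (fun y ↦ ∑ i ∈ s, a i * ψ i y) x = ∑ i ∈ s, (a i : ℂ) * fourierHat (ψ i) x := by
  simp only [fourierHat, ← integral_const_mul]
  rw [← integral_finsetSum]
  · congr 1 with y
    push_cast
    rw [Finset.mul_sum]
    exact Finset.sum_congr rfl fun i _ ↦ by ring
  · intro i hi
    refine Integrable.const_mul ?_ _
    refine ((hψ i hi).ofReal (𝕜 := ℂ)).bdd_mul (c := 1) (by fun_prop) (ae_of_all _ fun y ↦ ?_)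
    rw [show Complex.I * (x : ℂ) * y = ((x * y : ℝ) : ℂ) * Complex.I by push_cast; ring,
      Complex.norm_exp_ofReal_mul_I]

theorem memLp_two_fourierHat (hψ : Integrable ψ) (hψ2 : MemLp ψ 2) :
    MemLp (fourierHat ψ) 2 := by
  have h := memLp_two_fourier (hψ.ofReal (𝕜 := ℂ)) hψ2.ofReal
  have hc : (-(2 * Real.pi)⁻¹ : ℝ) ≠ 0 := by
    have := Real.pi_pos; exact neg_ne_zero.2 (by positivity)
  rw [memLp_two_iff_integrable_sq_norm (continuous_fourierHat hψ).aestronglyMeasurable]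
  rw [memLp_two_iff_integrable_sq_norm h.1] at h
  exact (h.comp_mul_left' hc).congr (ae_of_all _ fun x ↦ by simp [fourierHat_eq_fourier])

/-- Parseval's identity, with the normalisation of `fourierHat`. -/
theorem integral_fourierHat_mul_conj (hψ : Integrable ψ) (hψ2 : MemLp ψ 2)
    (hφ : Integrable φ) (hφ2 : MemLp φ 2) :
    ∫ x, fourierHat ψ x * (starRingEnd ℂ) (fourierHat φ x) =
      (2 * Real.pi : ℂ) * ((∫ y, ψ y * φ y : ℝ) : ℂ) := by
  have h := integral_fourier_mul_conj_fourier (hψ.ofReal (𝕜 := ℂ)) hψ2.ofReal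
    (hφ.ofReal (𝕜 := ℂ)) hφ2.ofReal
  simp_rw [fourierHat_eq_fourier]
  rw [Measure.integral_comp_mul_left (fun y ↦ _ * (starRingEnd ℂ) _)]
  erw [h]
  rw [← integral_complex_ofReal]
  have := Real.pi_pos
  rw [show |(-(2 * Real.pi)⁻¹)⁻¹| = 2 * Real.pi by
    rw [inv_neg, inv_inv, abs_neg, abs_of_pos (by positivity)]]
  rw [Complex.real_smul]
  push_cast
  simp

/-- The Fourier representation of the correlation function of `ψ`. -/
theorem integral_mul_comp_add_eq (hψ : Integrable ψ) (hψ2 : MemLp ψ 2) (a b : ℝ) :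
    ((∫ y, ψ (y + a) * ψ (y + b) : ℝ) : ℂ) =
      (2 * Real.pi : ℂ)⁻¹ * ∫ x, Complex.exp (((x * (b - a) : ℝ) : ℂ) * Complex.I) *
        ((‖fourierHat ψ x‖ ^ 2 : ℝ) : ℂ) := by
  have hπ : (2 * Real.pi : ℂ) ≠ 0 := by simp [Real.pi_ne_zero]
  have ht : ∀ c, MemLp (fun y ↦ ψ (y + c)) 2 := fun c ↦
    hψ2.comp_measurePreserving (measurePreserving_add_right volume c)
  rw [eq_inv_mul_iff_mul_eq₀ hπ, ← integral_fourierHat_mul_conj (hψ.comp_add_right a) (ht a)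
    (hψ.comp_add_right b) (ht b)]
  congr 1 with x
  rw [fourierHat_comp_add, fourierHat_comp_add, map_mul, ← Complex.exp_conj]
  rw [show ((‖fourierHat ψ x‖ ^ 2 : ℝ) : ℂ) = fourierHat ψ x * (starRingEnd ℂ) (fourierHat ψ x) by
    rw [Complex.mul_conj, Complex.normSq_eq_norm_sq]]
  rw [mul_mul_mul_comm, ← Complex.exp_add]
  congr 2
  simp
  ring

/-- Since `0 < α < 1`, the singularity of `1 / |x| ^ α` is integrable, and this function is bounded
away from it. -/
theorem integrable_mul_one_div_abs_rpow {α : ℝ} (hα0 : 0 < α) (hα1 : α < 1) {f : ℝ → ℝ}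
    (hf : Integrable f) (hf0 : ∀ x, 0 ≤ f x) {K : ℝ} (hK : ∀ x, f x ≤ K) :
    Integrable (fun x ↦ f x * (1 / |x| ^ α)) := by
  have hmeas : AEStronglyMeasurable (fun x ↦ f x * (1 / |x| ^ α)) := by
    have h : Measurable (fun x : ℝ ↦ 1 / |x| ^ α) := by fun_prop
    exact hf.1.mul h.aestronglyMeasurable
  have hloc : IntegrableOn (fun x : ℝ ↦ |x| ^ (-α)) (Set.Icc (-1) 1) := by
    have h1 : IntegrableOn (fun x : ℝ ↦ |x| ^ (-α)) (Set.Ioc 0 1) := by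
      have := (intervalIntegral.intervalIntegrable_rpow' (a := 0) (b := 1)
        (by linarith : -1 < -α)).1
      exact this.congr_fun (fun x hx ↦ by rw [abs_of_pos hx.1]) measurableSet_Ioc
    have h2 : IntegrableOn (fun x : ℝ ↦ |x| ^ (-α)) (Set.Ico (-1) 0) := by
      have := h1.comp_neg
      simpa using this
    have h3 := (h2.union (integrableOn_singleton (x := (0 : ℝ)) (by simp) (by simp))).union h1
    refine h3.mono_set fun x hx ↦ ?_
    rcases lt_trichotomy x 0 with h | h | h
    · exact Or.inl (Or.inl ⟨hx.1, h⟩)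
    · exact Or.inl (Or.inr h)
    · exact Or.inr ⟨h, hx.2⟩
  have hg : Integrable (fun x ↦ (Set.Icc (-1 : ℝ) 1).indicator (fun x ↦ K * |x| ^ (-α)) x + f x) :=
    ((integrable_indicator_iff measurableSet_Icc).2 (hloc.const_mul _)).add hf
  refine hg.mono' hmeas (ae_of_all _ fun x ↦ ?_)
  have hpos : 0 ≤ 1 / |x| ^ α := by positivity
  rw [Real.norm_eq_abs, abs_of_nonneg (mul_nonneg (hf0 x) hpos)]
  by_cases hx : x ∈ Set.Icc (-1 : ℝ) 1
  · rw [Set.indicator_of_mem hx, Real.rpow_neg (abs_nonneg x), ← one_div]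
    linarith [mul_le_mul_of_nonneg_right (hK x) hpos, hf0 x]
  · rw [Set.indicator_of_notMem hx, zero_add]
    have h1 : 1 ≤ |x| := by
      by_contra h
      push Not at h
      exact hx (Set.mem_Icc.2 (abs_le.1 h.le))
    have : 1 / |x| ^ α ≤ 1 := by
      rw [div_le_one (by positivity)]
      exact Real.one_le_rpow h1 hα0.le
    exact mul_le_of_le_one_right (hf0 x) this

theorem integrable_norm_sq_fourierHat (hψ : Integrable ψ) (hψ2 : MemLp ψ 2) :
    Integrable (fun x ↦ ‖fourierHat ψ x‖ ^ 2) :=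
  (memLp_two_iff_integrable_sq_norm (continuous_fourierHat hψ).aestronglyMeasurable).1
    (memLp_two_fourierHat hψ hψ2)

theorem integrable_norm_sq_fourierHat_div {α : ℝ} (hα0 : 0 < α) (hα1 : α < 1)
    (hψ : Integrable ψ) (hψ2 : MemLp ψ 2) :
    Integrable (fun x ↦ ‖fourierHat ψ x‖ ^ 2 * (1 / |x| ^ α)) :=
  integrable_mul_one_div_abs_rpow hα0 hα1 (integrable_norm_sq_fourierHat hψ hψ2)
    (fun _ ↦ by positivity) (K := (∫ y, |ψ y|) ^ 2) fun x ↦ by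
      have := norm_fourierHat_le ψ x
      gcongr

/-- The square root of the spectral density: `ψ̂ / √π` times `|x| ^ (-α / 2)`. The covariance of
the limit is the real inner product of these functions in `L²(ℝ; ℂ)`. -/
noncomputable def spectralFunction (α : ℝ) (ψ : ℝ → ℝ) (x : ℝ) : ℂ :=
  (((Real.sqrt Real.pi)⁻¹ * Real.sqrt (1 / |x| ^ α) : ℝ) : ℂ) * fourierHat ψ x

theorem memLp_spectralFunction {α : ℝ} (hα0 : 0 < α) (hα1 : α < 1)
    (hψ : Integrable ψ) (hψ2 : MemLp ψ 2) : MemLp (spectralFunction α ψ) 2 := by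
  have hm : Measurable (spectralFunction α ψ) := by
    have := (continuous_fourierHat hψ).measurable
    unfold spectralFunction
    fun_prop
  rw [memLp_two_iff_integrable_sq_norm hm.aestronglyMeasurable]
  refine ((integrable_norm_sq_fourierHat_div hα0 hα1 hψ hψ2).const_mul (Real.pi⁻¹)).congr
    (ae_of_all _ fun x ↦ ?_)
  simp only [spectralFunction]
  have h0 : 0 ≤ (Real.sqrt Real.pi)⁻¹ * Real.sqrt (1 / |x| ^ α) := by positivity
  rw [norm_mul, Complex.norm_real, Real.norm_eq_abs, abs_of_nonneg h0, mul_pow, mul_pow, inv_pow,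
    Real.sq_sqrt Real.pi_pos.le, Real.sq_sqrt (by positivity)]
  ring

theorem spectralFunction_mul_conj (α : ℝ) (ψ φ : ℝ → ℝ) (x : ℝ) :
    spectralFunction α ψ x * (starRingEnd ℂ) (spectralFunction α φ x) =
      (1 / (Real.pi : ℂ)) * covarianceIntegrand α ψ φ x := by
  have h : (((Real.sqrt Real.pi)⁻¹ * Real.sqrt (1 / |x| ^ α) : ℝ) : ℂ) ^ 2 =
      (1 / (Real.pi : ℂ)) * ((1 / |x| ^ α : ℝ) : ℂ) := by
    rw [← Complex.ofReal_pow, mul_pow, inv_pow, Real.sq_sqrt Real.pi_pos.le,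
      Real.sq_sqrt (by positivity)]
    push_cast
    simp
  rw [spectralFunction, spectralFunction, covarianceIntegrand, map_mul, Complex.conj_ofReal,
    mul_mul_mul_comm, ← sq, h]
  ring

theorem integrable_covarianceIntegrand {α : ℝ} (hα0 : 0 < α) (hα1 : α < 1)
    (hψ : Integrable ψ) (hψ2 : MemLp ψ 2) (hφ : Integrable φ) (hφ2 : MemLp φ 2) :
    Integrable (covarianceIntegrand α ψ φ) := by
  have h := (memLp_spectralFunction hα0 hα1 hψ hψ2).integrable_mul
    (memLp_spectralFunction hα0 hα1 hφ hφ2).star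
  refine (h.const_mul (Real.pi : ℂ)).congr (ae_of_all _ fun x ↦ ?_)
  have := spectralFunction_mul_conj α ψ φ x
  have hπ : (Real.pi : ℂ) ≠ 0 := by simp [Real.pi_ne_zero]
  simp only [Pi.mul_apply, Pi.star_apply, RCLike.star_def]
  rw [this]
  field_simp

/-- The integral of `covarianceIntegrand` is real, because `ψ̂(-x)` is the conjugate of `ψ̂(x)`. -/
theorem ofReal_integral_re_covariance (α : ℝ) (ψ φ : ℝ → ℝ) :
    (((∫ y, covarianceIntegrand α ψ φ y).re : ℝ) : ℂ) = ∫ y, covarianceIntegrand α ψ φ y := by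
  rw [← Complex.conj_eq_iff_re, ← integral_conj, ← integral_neg_eq_self]
  congr 1 with x
  simp only [covarianceIntegrand, fourierHat_neg, abs_neg, map_mul, Complex.conj_conj,
    Complex.conj_ofReal]

end FourierHat

/-! ### Isonormal Gaussian processes -/

theorem norm_exp_mul_I_sub_exp_mul_I_le (a b : ℝ) :
    ‖Complex.exp (a * Complex.I) - Complex.exp (b * Complex.I)‖ ≤ |a - b| := by
  have h : Complex.exp (a * Complex.I) - Complex.exp (b * Complex.I) =
      Complex.exp (b * Complex.I) * (Complex.exp (Complex.I * ((a - b : ℝ) : ℂ)) - 1) := by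
    rw [mul_sub, ← Complex.exp_add, mul_one]
    congr 2
    push_cast
    ring
  rw [h, norm_mul, Complex.norm_exp_ofReal_mul_I, one_mul]
  exact Real.norm_exp_I_mul_ofReal_sub_one_le

theorem integrable_exp_mul_I {Ω : Type*} [MeasurableSpace Ω] {P : Measure Ω} [IsFiniteMeasure P]
    {f : Ω → ℝ} (hf : AEStronglyMeasurable f P) :
    Integrable (fun ω ↦ Complex.exp (f ω * Complex.I)) P := by
  refine (integrable_const (1 : ℝ)).mono' ?_ (ae_of_all _ fun ω ↦ ?_)
  · exact Complex.continuous_exp.comp_aestronglyMeasurable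
      ((Complex.continuous_ofReal.comp_aestronglyMeasurable hf).mul_const _)
  · rw [Complex.norm_exp_ofReal_mul_I]

theorem norm_integral_exp_mul_I_sub_le {Ω : Type*} [MeasurableSpace Ω] {P : Measure Ω}
    [IsProbabilityMeasure P] (f g : Lp ℝ 2 P) :
    ‖∫ ω, Complex.exp (f ω * Complex.I) ∂P - ∫ ω, Complex.exp (g ω * Complex.I) ∂P‖ ≤
      ‖f - g‖ := by
  have hi : Integrable (fun ω ↦ f ω - g ω) P :=
    ((Lp.memLp f).sub (Lp.memLp g)).integrable one_le_two
  rw [← integral_sub (integrable_exp_mul_I (Lp.aestronglyMeasurable f))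
    (integrable_exp_mul_I (Lp.aestronglyMeasurable g))]
  calc _ ≤ ∫ ω, |f ω - g ω| ∂P := norm_integral_le_of_norm_le hi.abs
            (ae_of_all _ fun ω ↦ norm_exp_mul_I_sub_exp_mul_I_le _ _)
    _ = (eLpNorm (fun ω ↦ f ω - g ω) 1 P).toReal := by
      rw [eLpNorm_one_eq_lintegral_enorm, ← integral_norm_eq_lintegral_enorm hi.1]
      rfl
    _ ≤ (eLpNorm (fun ω ↦ f ω - g ω) 2 P).toReal :=
      ENNReal.toReal_mono ((Lp.memLp f).sub (Lp.memLp g)).2.ne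
        (eLpNorm_le_eLpNorm_of_exponent_le one_le_two hi.1)
    _ = ‖f - g‖ := by
      rw [Lp.norm_def]
      congr 1
      exact eLpNorm_congr_ae (Lp.coeFn_sub f g).symm

/-- Every real Hilbert space embeds isometrically into an `L²` space as a space of centred Gaussian
variables: send a Hilbert basis to independent standard Gaussian variables. -/
theorem exists_isonormal (H : Type) [NormedAddCommGroup H] [InnerProductSpace ℝ H]
    [CompleteSpace H] :
    ∃ (Ω' : Type) (_ : MeasurableSpace Ω') (P' : Measure Ω') (_ : IsProbabilityMeasure P')
      (W : H →ₗᵢ[ℝ] Lp ℝ 2 P'),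
      ∀ h, ∫ ω, Complex.exp (W h ω * Complex.I) ∂P' = Complex.exp (-((‖h‖ ^ 2 / 2 : ℝ) : ℂ)) := by
  classical
  obtain ⟨w, b, -⟩ := exists_hilbertBasis ℝ H
  set P' : Measure (w → ℝ) := Measure.infinitePi (fun _ ↦ gaussianReal 0 1) with hP'
  have hmap : ∀ i, P'.map (fun ω ↦ ω i) = gaussianReal 0 1 := fun i ↦
    Measure.infinitePi_map_eval _ i
  have hind : iIndepFun (fun (i : w) (ω : w → ℝ) ↦ ω i) P' :=
    iIndepFun_infinitePi (X := fun _ y ↦ y) fun _ ↦ measurable_id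
  have hmem : ∀ i, MemLp (fun ω : w → ℝ ↦ ω i) 2 P' := fun i ↦ by
    have h : MemLp id 2 (P'.map (fun ω ↦ ω i)) := by
      rw [hmap]; exact IsGaussian.memLp_two_id
    exact h.comp_of_map (measurable_pi_apply i).aemeasurable
  have hint1 : ∀ i, ∫ ω, ω i ∂P' = 0 := fun i ↦ by
    have := integral_map (μ := P') (φ := fun ω ↦ ω i) (measurable_pi_apply i).aemeasurable
      (f := id) measurable_id.aestronglyMeasurable
    rw [hmap] at this
    simpa using this.symm
  have hint2 : ∀ i, ∫ ω, ω i * ω i ∂P' = 1 := fun i ↦ by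
    have := integral_map (μ := P') (φ := fun ω ↦ ω i) (measurable_pi_apply i).aemeasurable
      (f := fun y ↦ y * y) (by fun_prop)
    rw [hmap] at this
    rw [← this]
    have hv := variance_eq_sub (μ := gaussianReal 0 1) (X := id) IsGaussian.memLp_two_id
    rw [variance_id_gaussianReal] at hv
    simp [sq] at hv
    exact hv.symm
  set v : w → Lp ℝ 2 P' := fun i ↦ (hmem i).toLp _ with hv
  have hvinner : ∀ i j, inner ℝ (v i) (v j) = ∫ ω, ω j * ω i ∂P' := fun i j ↦ by
    rw [L2.inner_def]
    refine integral_congr_ae ?_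
    filter_upwards [(hmem i).coeFn_toLp, (hmem j).coeFn_toLp] with ω h1 h2
    rw [hv, h1, h2, RCLike.inner_apply]
    simp
  have horth : Orthonormal ℝ v := by
    rw [orthonormal_iff_ite]
    intro i j
    rw [hvinner]
    split_ifs with h
    · subst h; exact hint2 i
    · have := (hind.indepFun (Ne.symm h)).integral_fun_mul_eq_mul_integral
        (measurable_pi_apply j).aestronglyMeasurable (measurable_pi_apply i).aestronglyMeasurable
      rw [this, hint1, zero_mul]
  refine ⟨w → ℝ, inferInstance, P', inferInstance,
    horth.orthogonalFamily.linearIsometry.comp b.repr.toLinearIsometry, fun h ↦ ?_⟩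
  set W : H →ₗᵢ[ℝ] Lp ℝ 2 P' :=
    horth.orthogonalFamily.linearIsometry.comp b.repr.toLinearIsometry with hW
  have hWb : ∀ i, W (b i) = v i := fun i ↦ by
    simp only [hW, LinearIsometry.coe_comp, Function.comp_apply,
      LinearIsometryEquiv.coe_toLinearIsometry, b.repr_self]
    rw [OrthogonalFamily.linearIsometry_apply_single]
    simp
  -- finite linear combinations of the basis
  have hfin : ∀ (s : Finset w) (c : w → ℝ),
      ∫ ω, Complex.exp (W (∑ i ∈ s, c i • b i) ω * Complex.I) ∂P' =
        Complex.exp (-((‖∑ i ∈ s, c i • b i‖ ^ 2 / 2 : ℝ) : ℂ)) := by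
    intro s c
    have h1 : (W (∑ i ∈ s, c i • b i) : (w → ℝ) → ℝ) =ᵐ[P'] fun ω ↦ ∑ i ∈ s, c i * ω i := by
      have : W (∑ i ∈ s, c i • b i) = (memLp_finsetSum s (f := fun i ω ↦ c i * ω i)
          (fun i _ ↦ (hmem i).const_mul (c i))).toLp _ := by
        rw [map_sum]
        simp_rw [map_smul, hWb, hv]
        induction s using Finset.induction with
        | empty => simp
        | insert a s ha ih =>
          rw [Finset.sum_insert ha, ih, ← MemLp.toLp_const_smul, ← MemLp.toLp_add]
          congr 1
          ext ω
          simp [Finset.sum_insert ha]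
      rw [this]
      exact MemLp.coeFn_toLp _
    have h2 := (hind.comp (fun i y ↦ c i * y) (fun i ↦ measurable_const_mul (c i)))
    have hm : ∀ i ∈ s, AEMeasurable (fun ω : w → ℝ ↦ c i * ω i) P' := by
      intro i _
      have h := (measurable_pi_apply (X := fun _ : w ↦ ℝ) i).const_mul (c i)
      exact h.aemeasurable
    have h3 := iIndepFun.charFun_map_fun_finsetSum_eq_prod (s := s) (P := P')
      (X := fun (i : w) (ω : w → ℝ) ↦ c i * ω i) hm
      (h2.precomp (g := fun i : s ↦ (i : w)) Subtype.val_injective)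
    have h4 := congrFun h3 1
    have hms : AEMeasurable (fun ω : w → ℝ ↦ ∑ i ∈ s, c i * ω i) P' :=
      Finset.aemeasurable_fun_sum s hm
    rw [charFun_apply_real, integral_map hms (by fun_prop)] at h4
    have h5 : ∀ i, charFun (P'.map (fun ω ↦ c i * ω i)) 1 =
        Complex.exp (-((c i ^ 2 / 2 : ℝ) : ℂ)) := fun i ↦ by
      have := charFun_map_mul (μ := P'.map (fun ω ↦ ω i)) (c i) 1
      rw [Measure.map_map (by fun_prop) (by fun_prop)] at this
      have h6 : ((fun x ↦ c i * x) ∘ fun ω : w → ℝ ↦ ω i) = fun ω ↦ c i * ω i := rfl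
      rw [h6] at this
      rw [this, hmap, charFun_gaussianReal]
      congr 1
      push_cast
      simp
    rw [integral_congr_ae (g := fun ω ↦ Complex.exp (((1 : ℝ) : ℂ) *
      ((∑ i ∈ s, c i * ω i : ℝ) : ℂ) * Complex.I))
      (by filter_upwards [h1] with ω hω; rw [hω]; simp), h4, Finset.prod_apply]
    simp_rw [h5]
    rw [← Complex.exp_sum]
    congr 1
    rw [← real_inner_self_eq_norm_sq, b.orthonormal.inner_sum, Finset.sum_div,
      Finset.sum_neg_distrib]
    push_cast
    simp [sq]
  have hsum := b.hasSum_repr h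
  have hcont : Continuous (fun f : Lp ℝ 2 P' ↦ ∫ ω, Complex.exp (f ω * Complex.I) ∂P') := by
    refine LipschitzWith.continuous (K := 1) (LipschitzWith.of_dist_le_mul fun f g ↦ ?_)
    rw [dist_eq_norm, dist_eq_norm, NNReal.coe_one, one_mul]
    exact norm_integral_exp_mul_I_sub_le f g
  have hA := ((hcont.comp W.continuous).tendsto h).comp hsum
  have hB : Continuous (fun k : H ↦ Complex.exp (-((‖k‖ ^ 2 / 2 : ℝ) : ℂ))) := by fun_prop
  refine tendsto_nhds_unique hA (((hB.tendsto h).comp hsum).congr fun s ↦ ?_)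
  exact (hfin s _).symm

/-- The conclusion of `exists_isonormal` in terms of a Gaussian process: every family in a real
Hilbert space is the covariance structure of a centred Gaussian process. -/
theorem exists_gaussianProcess {H : Type} [NormedAddCommGroup H] [InnerProductSpace ℝ H]
    [CompleteSpace H] {T : Type*} (h : T → H) :
    ∃ (Ω' : Type) (_ : MeasurableSpace Ω') (P' : Measure Ω') (_ : IsProbabilityMeasure P')
      (ϑ : T → Ω' → ℝ),
      IsGaussianProcess ϑ P' ∧ (∀ t, ∫ ω, ϑ t ω ∂P' = 0) ∧
      (∀ t s, ∫ ω, ϑ t ω * ϑ s ω ∂P' = inner ℝ (h t) (h s)) ∧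
      (∀ t, AEMeasurable (ϑ t) P') ∧
      ∀ (I : Finset T) (a : I → ℝ), ∫ ω, Complex.exp ((∑ i, a i * ϑ i ω : ℝ) * Complex.I) ∂P' =
        Complex.exp (-((‖∑ i, a i • h i‖ ^ 2 / 2 : ℝ) : ℂ)) := by
  classical
  obtain ⟨Ω', mΩ', P', hP', W, hW⟩ := exists_isonormal H
  have hlin : ∀ (I : Finset T) (a : I → ℝ),
      (W (∑ i, a i • h i) : Ω' → ℝ) =ᵐ[P'] fun ω ↦ ∑ i, a i * W (h i) ω := by
    intro I a
    rw [map_sum]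
    have h1 := Lp.coeFn_finsetSum (Finset.univ) (fun i : I ↦ W (a i • h i))
    have h2 : ∀ᵐ ω ∂P', ∀ i : I, W (a i • h i) ω = a i * W (h i) ω := by
      rw [ae_all_iff]
      intro i
      rw [map_smul]
      exact Lp.coeFn_smul _ _
    filter_upwards [h1, h2] with ω h1 h2
    rw [h1, Finset.sum_apply]
    exact Finset.sum_congr rfl fun i _ ↦ h2 i
  have hchar : ∀ (I : Finset T) (a : I → ℝ),
      ∫ ω, Complex.exp ((∑ i, a i * W (h i) ω : ℝ) * Complex.I) ∂P' =
        Complex.exp (-((‖∑ i, a i • h i‖ ^ 2 / 2 : ℝ) : ℂ)) := by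
    intro I a
    rw [← hW]
    refine integral_congr_ae ?_
    filter_upwards [hlin I a] with ω hω
    rw [hω]
  have hmeas : ∀ t, AEMeasurable (W (h t) : Ω' → ℝ) P' := fun t ↦
    (Lp.aestronglyMeasurable _).aemeasurable
  have hlaw : ∀ k, P'.map (W k) = gaussianReal 0 (‖k‖₊ ^ 2) := by
    intro k
    have hm : AEMeasurable (W k : Ω' → ℝ) P' := (Lp.aestronglyMeasurable _).aemeasurable
    refine Measure.ext_of_charFun (funext fun u ↦ ?_)
    rw [charFun_apply_real, integral_map hm (by fun_prop), charFun_gaussianReal]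
    have h1 := hW (u • k)
    rw [norm_smul] at h1
    refine Eq.trans (integral_congr_ae ?_) (h1.trans ?_)
    · rw [map_smul]
      filter_upwards [Lp.coeFn_smul u (W k)] with ω hω
      rw [hω]
      simp
    · congr 1
      simp [mul_pow]
      ring
  refine ⟨Ω', mΩ', P', hP', fun t ↦ W (h t), ⟨fun I ↦ ⟨?_⟩⟩, fun t ↦ ?_, fun t s ↦ ?_, hmeas, hchar⟩
  · have hmI : AEMeasurable (fun ω ↦ I.restrict (fun t ↦ W (h t) ω)) P' :=
      aemeasurable_pi_lambda _ fun i ↦ hmeas i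
    refine isGaussian_of_map_eq_gaussianReal fun L ↦ ?_
    refine ⟨0, ‖∑ i : I, L (Pi.single i 1) • h i‖₊ ^ 2, ?_⟩
    rw [AEMeasurable.map_map_of_aemeasurable (by fun_prop) hmI, ← hlaw]
    refine Measure.map_congr ?_
    filter_upwards [hlin I (fun i ↦ L (Pi.single i 1))] with ω hω
    rw [hω, Function.comp_apply]
    conv_lhs => rw [← Finset.univ_sum_single (I.restrict fun t ↦ W (h t) ω), map_sum]
    refine Finset.sum_congr rfl fun i _ ↦ ?_
    rw [Finset.restrict]
    have : (Pi.single i (W (h i) ω) : I → ℝ) = W (h i) ω • Pi.single i 1 := by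
      rw [← Pi.single_smul]; simp
    rw [this, map_smul, smul_eq_mul, mul_comm]
  · have h1 := integral_map (μ := P') (hmeas t) (f := id) measurable_id.aestronglyMeasurable
    rw [hlaw] at h1
    simpa using h1.symm
  · rw [← W.inner_map_map, L2.inner_def]
    refine integral_congr_ae (ae_of_all _ fun ω ↦ ?_)
    simp [RCLike.inner_apply, mul_comm]

/-! ### Marked Poisson random measures -/

theorem integral_pow_poissonMeasure (r : ℝ≥0) (z : ℂ) :
    ∫ n, z ^ n ∂(poissonMeasure r) = Complex.exp (r * (z - 1)) := by
  rw [integral_poissonMeasure r]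
  calc ∑' n : ℕ, (Real.exp (-r) * r ^ n / n.factorial : ℝ) • z ^ n
      = ∑' n : ℕ, (Real.exp (-r) : ℂ) * ((r * z) ^ n / n.factorial) := by
        congr with n
        rw [Complex.real_smul, mul_pow]
        push_cast
        ring
    _ = (Real.exp (-r) : ℂ) * ∑' n : ℕ, ((r * z) ^ n / n.factorial) := tsum_mul_left
    _ = (Real.exp (-r) : ℂ) * Complex.exp (r * z) := by
        rw [(NormedSpace.expSeries_div_hasSum_exp ((r : ℂ) * z)).tsum_eq, Complex.exp_eq_exp_ℂ]
    _ = Complex.exp (r * (z - 1)) := by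
        rw [Complex.ofReal_exp, ← Complex.exp_add]
        push_cast
        ring_nf

theorem lintegral_cast_poissonMeasure (r : ℝ≥0) :
    ∫⁻ n, (n : ℝ≥0∞) ∂(poissonMeasure r) = r := by
  rw [poissonMeasure, lintegral_sum_measure]
  simp_rw [lintegral_smul_measure, lintegral_dirac, smul_eq_mul]
  have hs := (hasSum_one_poissonMeasure r).mul_left (r : ℝ)
  rw [mul_one] at hs
  have h0 : ∀ n : ℕ, 0 ≤ (r : ℝ) * (Real.exp (-r) * r ^ n / n.factorial) := fun n ↦ by positivity
  rw [tsum_eq_zero_add' ENNReal.summable]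
  have h1 : ∀ n : ℕ, ENNReal.ofReal (Real.exp (-r) * r ^ (n + 1) / (n + 1).factorial) *
      ((n + 1 : ℕ) : ℝ≥0∞) = ENNReal.ofReal ((r : ℝ) * (Real.exp (-r) * r ^ n / n.factorial)) := by
    intro n
    rw [← ENNReal.ofReal_natCast, ← ENNReal.ofReal_mul (by positivity)]
    congr 1
    rw [Nat.factorial_succ]
    push_cast
    have : ((n : ℝ) + 1) ≠ 0 := by positivity
    have : (n.factorial : ℝ) ≠ 0 := by positivity
    field_simp
    ring
  simp_rw [h1]
  rw [← ENNReal.ofReal_tsum_of_nonneg h0 hs.summable, hs.tsum_eq]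
  simp

/-- A product of numbers in the closed unit disc is a Lipschitz function of its factors. -/
theorem Finset.norm_prod_sub_prod_le_sum {ι : Type*} (s : Finset ι) (a b : ι → ℂ)
    (ha : ∀ i, ‖a i‖ ≤ 1) (hb : ∀ i, ‖b i‖ ≤ 1) :
    ‖∏ i ∈ s, a i - ∏ i ∈ s, b i‖ ≤ ∑ i ∈ s, ‖a i - b i‖ := by
  classical
  induction s using Finset.induction with
  | empty => simp
  | insert j s hj ih =>
    rw [Finset.prod_insert hj, Finset.prod_insert hj, Finset.sum_insert hj]
    have h1 : ‖∏ i ∈ s, b i‖ ≤ 1 := by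
      rw [norm_prod]
      exact Finset.prod_le_one (fun i _ ↦ norm_nonneg _) fun i _ ↦ hb i
    calc ‖a j * ∏ i ∈ s, a i - b j * ∏ i ∈ s, b i‖
        = ‖a j * (∏ i ∈ s, a i - ∏ i ∈ s, b i) + (a j - b j) * ∏ i ∈ s, b i‖ := by ring_nf
      _ ≤ ‖a j‖ * ‖∏ i ∈ s, a i - ∏ i ∈ s, b i‖ + ‖a j - b j‖ * ‖∏ i ∈ s, b i‖ := by
        rw [← norm_mul, ← norm_mul]; exact norm_add_le _ _
      _ ≤ 1 * (∑ i ∈ s, ‖a i - b i‖) + ‖a j - b j‖ * 1 := by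
        gcongr
        exact ha j
      _ = _ := by ring

section PoissonStart

variable {Ω : Type*} [MeasurableSpace Ω] {P : Measure Ω} {x : ℕ → Ω → ℝ}

/-- The intensity of a Poisson point process on the line is the sum of the laws of its points. -/
theorem sum_map_eq_volume (hx : ∀ i, Measurable (x i))
    (hP : IsPoissonRandomMeasure (fun ω ↦ Measure.sum (fun i ↦ Measure.dirac (x i ω)))
      (volume : Measure ℝ) P) :
    Measure.sum (fun i ↦ P.map (x i)) = (volume : Measure ℝ) := by
  have key : ∀ A : Set ℝ, MeasurableSet A → volume A ≠ ∞ →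
      Measure.sum (fun i ↦ P.map (x i)) A = volume A := by
    intro A hA hfin
    have h1 := (hP.hasLaw A hA hfin).lintegral_comp (f := id) aemeasurable_id
    rw [lintegral_map measurable_id (by fun_prop)] at h1
    simp only [id] at h1
    rw [lintegral_cast_poissonMeasure, ENNReal.coe_toNNReal hfin] at h1
    rw [← h1, Measure.sum_apply _ hA]
    simp_rw [Measure.sum_apply _ hA]
    rw [lintegral_tsum]
    · congr with i
      rw [Measure.map_apply (hx i) hA, ← lintegral_indicator_one (hx i hA)]
      congr with ω
      rw [Measure.dirac_apply' _ hA]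
      rfl
    · intro i
      have : (fun ω ↦ Measure.dirac (x i ω) A) = (x i ⁻¹' A).indicator 1 := by
        ext ω
        rw [Measure.dirac_apply' _ hA]; rfl
      rw [this]
      exact (measurable_one.indicator (hx i hA)).aemeasurable
  refine Measure.ext_of_iUnion_eq_univ (s := fun n : ℕ ↦ Set.Icc (-(n : ℝ)) n) ?_ fun n ↦ ?_
  · refine Set.eq_univ_of_forall fun y ↦ Set.mem_iUnion.2 ?_
    obtain ⟨n, hn⟩ := exists_nat_ge |y|
    exact ⟨n, abs_le.1 hn⟩
  · ext A hA
    rw [Measure.restrict_apply hA, Measure.restrict_apply hA]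
    exact key _ (hA.inter measurableSet_Icc)
      (measure_ne_top_of_subset Set.inter_subset_right (by simp))

variable [IsProbabilityMeasure P]

/-- The generating functional of a Poisson point process at a simple function. The product over
the points is expressed through the numbers of points in the level sets, which are independent
Poisson variables. -/
theorem tendsto_integral_prod_one_add_simpleFunc (hx : ∀ i, Measurable (x i))
    (hP : IsPoissonRandomMeasure (fun ω ↦ Measure.sum (fun i ↦ Measure.dirac (x i ω)))
      (volume : Measure ℝ) P)
    (s : SimpleFunc ℝ ℂ) (hs : Integrable s) (hs1 : ∀ y, ‖1 + s y‖ ≤ 1) :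
    Tendsto (fun n ↦ ∫ ω, ∏ i ∈ Finset.range n, (1 + s (x i ω)) ∂P) atTop
      (𝓝 (Complex.exp (∫ y, s y))) := by
  classical
  set R : Finset ℂ := s.range.filter (· ≠ 0) with hR
  set e : Fin R.card ≃ R := R.equivFin.symm with he
  set A : Fin R.card → Set ℝ := fun k ↦ s ⁻¹' {(e k : ℂ)} with hA
  have hAm : ∀ k, MeasurableSet (A k) := fun k ↦ s.measurableSet_preimage _
  have hek : ∀ k, (e k : ℂ) ≠ 0 := fun k ↦ (Finset.mem_filter.1 (e k).2).2
  have hAfin : ∀ k, volume (A k) ≠ ∞ := fun k ↦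
    (SimpleFunc.measure_preimage_lt_top_of_integrable s hs (hek k)).ne
  have hdisj : Pairwise fun i j ↦ Disjoint (A i) (A j) := by
    intro i j hij
    refine Set.disjoint_left.2 fun y hy hy' ↦ hij ?_
    have h1 : s y = e i := hy
    have h2 : s y = e j := hy'
    exact e.injective (Subtype.ext (h1.symm.trans h2))
  set N : Fin R.card → Ω → ℝ≥0∞ := fun k ω ↦ Measure.sum (fun i ↦ Measure.dirac (x i ω)) (A k)
    with hN
  set f : Fin R.card → ℝ≥0∞ → ℂ := fun k y ↦ (1 + (e k : ℂ)) ^ ⌊y.toNNReal⌋₊ with hf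
  have hfm : ∀ k, Measurable (f k) := fun k ↦ by
    exact (measurable_from_nat (f := fun n ↦ (1 + (e k : ℂ)) ^ n)).comp
      (Nat.measurable_floor.comp ENNReal.measurable_toNNReal)
  have hNm : ∀ k, Measurable (N k) := fun k ↦ hP.measurable _ (hAm k)
  have hlaw := fun k ↦ hP.hasLaw (A k) (hAm k) (hAfin k)
  have hNfin : ∀ᵐ ω ∂P, ∀ k, N k ω ≠ ∞ := by
    rw [ae_all_iff]
    intro k
    have h1 := (hlaw k).lintegral_comp (f := id) aemeasurable_id
    rw [lintegral_map measurable_id (by fun_prop)] at h1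
    simp only [id] at h1
    rw [lintegral_cast_poissonMeasure] at h1
    filter_upwards [ae_lt_top (hNm k) (by rw [h1]; exact ENNReal.coe_ne_top)] with ω hω
    exact hω.ne
  have hNcount : ∀ k ω, N k ω = ∑' i, (A k).indicator 1 (x i ω) := fun k ω ↦ by
    change Measure.sum (fun i ↦ Measure.dirac (x i ω)) (A k) = _
    rw [Measure.sum_apply _ (hAm k)]
    simp_rw [Measure.dirac_apply' _ (hAm k)]
  have hprod : ∀ (n : ℕ) ω, ∏ i ∈ Finset.range n, (1 + s (x i ω)) =
      ∏ k, (1 + (e k : ℂ)) ^ ((Finset.range n).filter fun i ↦ x i ω ∈ A k).card := by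
    intro n ω
    have h1 : ∀ y, 1 + s y = ∏ k, if y ∈ A k then 1 + (e k : ℂ) else 1 := by
      intro y
      by_cases h0 : s y = 0
      · rw [h0, add_zero, Finset.prod_eq_one]
        intro k _
        rw [if_neg]
        intro (hk : s y = e k)
        exact hek k (hk.symm.trans h0)
      · have hmem : s y ∈ R := Finset.mem_filter.2 ⟨s.mem_range_self y, h0⟩
        rw [Finset.prod_eq_single (e.symm ⟨s y, hmem⟩)]
        · rw [if_pos]
          · simp
          · change s y = e _
            simp
        · intro k _ hk
          rw [if_neg]
          intro (hk' : s y = e k)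
          refine hk (e.injective (Subtype.ext ?_))
          simp [hk']
        · simp
    simp_rw [h1]
    rw [Finset.prod_comm]
    refine Finset.prod_congr rfl fun k _ ↦ ?_
    rw [Finset.prod_ite, Finset.prod_const, Finset.prod_const_one, mul_one]
  have hlim : ∀ᵐ ω ∂P, Tendsto (fun n ↦ ∏ i ∈ Finset.range n, (1 + s (x i ω))) atTop
      (𝓝 (∏ k, f k (N k ω))) := by
    filter_upwards [hNfin] with ω hω
    simp_rw [hprod]
    refine tendsto_finsetProd _ fun k _ ↦ ?_
    have hS : {i | x i ω ∈ A k}.Finite := by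
      have h1 := hω k
      rw [hNcount] at h1
      refine (ENNReal.finite_const_le_of_tsum_ne_top h1 one_ne_zero).subset fun i hi ↦ ?_
      have hi' : x i ω ∈ A k := hi
      simp [Set.indicator_of_mem hi']
    have hNk : N k ω = hS.toFinset.card := by
      rw [hNcount, tsum_eq_sum (s := hS.toFinset)]
      · rw [Finset.sum_congr rfl (g := fun _ ↦ (1 : ℝ≥0∞)), Finset.sum_const, nsmul_eq_mul, mul_one]
        intro i hi
        have hi' : x i ω ∈ A k := by simpa using hi
        simp [Set.indicator_of_mem hi']
      · intro i hi
        have hi' : x i ω ∉ A k := by simpa using hi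
        simp [Set.indicator_of_notMem hi']
    refine tendsto_const_nhds.congr' ?_
    obtain ⟨m, hm⟩ := hS.toFinset.exists_nat_subset_range
    filter_upwards [eventually_ge_atTop m] with n hn
    have : (Finset.range n).filter (fun i ↦ x i ω ∈ A k) = hS.toFinset := by
      ext i
      simp only [Finset.mem_filter, Finset.mem_range, Set.Finite.mem_toFinset, Set.mem_ofPred_eq,
        and_iff_right_iff_imp]
      intro hi
      have := Finset.mem_range.1 (hm (hS.mem_toFinset.2 hi))
      omega
    rw [this, hf, hNk]
    simp
  have hbound : ∀ (n : ℕ) ω, ‖∏ i ∈ Finset.range n, (1 + s (x i ω))‖ ≤ 1 := fun n ω ↦ by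
    rw [norm_prod]
    exact Finset.prod_le_one (fun i _ ↦ norm_nonneg _) fun i _ ↦ hs1 _
  have hDCT := tendsto_integral_of_dominated_convergence (μ := P) (fun _ ↦ (1 : ℝ))
    (fun n ↦ (Finset.measurable_fun_prod (Finset.range n) fun i _ ↦
      ((s.measurable.comp (hx i)).const_add 1)).aestronglyMeasurable)
    (integrable_const _) (fun n ↦ ae_of_all _ (hbound n)) hlim
  refine hDCT.trans (le_of_eq ?_)
  congr 1
  have hind := (hP.indep R.card A hAm hdisj).comp f hfm
  have h2 := hind.integral_fun_prod_eq_prod_integral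
    (fun k ↦ ((hfm k).comp (hNm k)).aestronglyMeasurable)
  have h3 : ∀ k, ∫ ω, f k (N k ω) ∂P = Complex.exp ((volume (A k)).toReal * e k) := by
    intro k
    have h4 := (hlaw k).integral_comp (f := f k) (hfm k).aestronglyMeasurable
    rw [integral_map (by fun_prop) (hfm k).aestronglyMeasurable] at h4
    have h5 : ∀ n : ℕ, f k n = (1 + (e k : ℂ)) ^ n := fun n ↦ by simp [hf]
    simp_rw [h5] at h4
    rw [integral_pow_poissonMeasure] at h4
    refine h4.trans ?_
    congr 1
    rw [add_sub_cancel_left]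
    rfl
  refine h2.trans ?_
  simp_rw [Function.comp_def]
  rw [Finset.prod_congr rfl fun k _ ↦ h3 k, ← Complex.exp_sum]
  congr 1
  rw [SimpleFunc.integral_eq_integral s hs |>.symm, SimpleFunc.integral_eq_sum_filter,
    ← hR, ← Finset.sum_coe_sort R, ← e.sum_comp]
  refine Finset.sum_congr rfl fun k _ ↦ ?_
  rw [Complex.real_smul]
  rfl

/-- The generating functional `E ∏ g(xᵢ) = exp ∫ (g - 1)` of a Poisson point process. -/
theorem tendsto_integral_prod_poisson (hx : ∀ i, Measurable (x i))
    (hP : IsPoissonRandomMeasure (fun ω ↦ Measure.sum (fun i ↦ Measure.dirac (x i ω)))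
      (volume : Measure ℝ) P)
    (g : ℝ → ℂ) (hg : Measurable g) (hg1 : ∀ y, ‖g y‖ ≤ 1) (hgi : Integrable (fun y ↦ g y - 1)) :
    Tendsto (fun n ↦ ∫ ω, ∏ i ∈ Finset.range n, g (x i ω) ∂P) atTop
      (𝓝 (Complex.exp (∫ y, (g y - 1)))) := by
  -- the values of the approximations of `g - 1` are kept in the disc `‖1 + z‖ ≤ 1`
  set B : Set ℂ := {z | ‖1 + z‖ ≤ 1} with hB
  have h0 : (0 : ℂ) ∈ B := by simp [hB]
  have hgm : Measurable (fun y ↦ g y - 1) := hg.sub_const 1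
  set s : ℕ → SimpleFunc ℝ ℂ := SimpleFunc.approxOn (fun y ↦ g y - 1) hgm B 0 h0 with hs
  have hsB : ∀ k y, ‖1 + s k y‖ ≤ 1 := fun k y ↦ SimpleFunc.approxOn_mem hgm h0 k y
  have hsi : ∀ k, Integrable (s k) := fun k ↦
    SimpleFunc.integrable_approxOn hgm hgi h0 (integrable_zero _ _ _) k
  have hL1 : Tendsto (fun k ↦ ∫⁻ y, ‖s k y - (g y - 1)‖ₑ) atTop (𝓝 0) := by
    refine SimpleFunc.tendsto_approxOn_L1_enorm hgm h0 (ae_of_all _ fun y ↦ subset_closure ?_) ?_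
    · simpa [hB] using hg1 y
    · simpa using hgi.2
  have hint : Tendsto (fun k ↦ ∫ y, s k y) atTop (𝓝 (∫ y, (g y - 1))) :=
    tendsto_integral_of_L1 _ hgi.1 (Eventually.of_forall hsi) hL1
  have hreal : Tendsto (fun k ↦ ∫ y, ‖s k y - (g y - 1)‖) atTop (𝓝 0) := by
    have := (ENNReal.tendsto_toReal ENNReal.zero_ne_top).comp hL1
    refine this.congr fun k ↦ ?_
    exact (integral_norm_eq_lintegral_enorm (f := fun y ↦ s k y - (g y - 1))
      ((hsi k).sub hgi).1).symm
  have hdiff : ∀ (k n : ℕ), ‖∫ ω, ∏ i ∈ Finset.range n, g (x i ω) ∂P -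
      ∫ ω, ∏ i ∈ Finset.range n, (1 + s k (x i ω)) ∂P‖ ≤ ∫ y, ‖s k y - (g y - 1)‖ := by
    intro k n
    have hm : ∀ {u : ℝ → ℂ}, Measurable u → (∀ y, ‖u y‖ ≤ 1) →
        Integrable (fun ω ↦ ∏ i ∈ Finset.range n, u (x i ω)) P := fun {u} hu hu1 ↦ by
      refine (integrable_const (1 : ℝ)).mono' (Finset.measurable_fun_prod _ fun i _ ↦
        hu.comp (hx i)).aestronglyMeasurable (ae_of_all _ fun ω ↦ ?_)
      rw [norm_prod]
      exact Finset.prod_le_one (fun i _ ↦ norm_nonneg _) fun i _ ↦ hu1 _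
    have hI : Integrable (fun y ↦ ‖s k y - (g y - 1)‖) := ((hsi k).sub hgi).norm
    have hIs : Integrable (fun y ↦ ‖s k y - (g y - 1)‖) (Measure.sum fun i ↦ P.map (x i)) := by
      rw [sum_map_eq_volume hx hP]; exact hI
    have hIi : ∀ i, Integrable (fun y ↦ ‖s k y - (g y - 1)‖) (P.map (x i)) := fun i ↦
      hIs.mono_measure (Measure.le_sum _ i)
    rw [← integral_sub (hm hg hg1) (hm ((s k).measurable.const_add 1) (hsB k))]
    calc _ ≤ ∫ ω, ∑ i ∈ Finset.range n, ‖s k (x i ω) - (g (x i ω) - 1)‖ ∂P := by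
          refine norm_integral_le_of_norm_le ?_ (ae_of_all _ fun ω ↦ ?_)
          · exact integrable_finsetSum _ fun i _ ↦ (hIi i).comp_measurable (hx i)
          · refine (Finset.norm_prod_sub_prod_le_sum _ _ _ (fun i ↦ hg1 _)
              (fun i ↦ hsB k _)).trans (le_of_eq ?_)
            refine Finset.sum_congr rfl fun i _ ↦ ?_
            rw [← norm_neg]
            congr 1
            ring
      _ = ∑ i ∈ Finset.range n, ∫ y, ‖s k y - (g y - 1)‖ ∂(P.map (x i)) := by
          have hIc : ∀ i, Integrable (fun ω ↦ ‖s k (x i ω) - (g (x i ω) - 1)‖) P := fun i ↦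
            (hIi i).comp_measurable (hx i)
          rw [integral_finsetSum _ fun i _ ↦ hIc i]
          refine Finset.sum_congr rfl fun i _ ↦ ?_
          rw [integral_map (hx i).aemeasurable (hIi i).1]
      _ ≤ ∫ y, ‖s k y - (g y - 1)‖ := by
          have hsum := hasSum_integral_measure hIs
          rw [sum_map_eq_volume hx hP] at hsum
          exact sum_le_hasSum _ (fun i _ ↦ integral_nonneg fun y ↦ norm_nonneg _) hsum
  rw [Metric.tendsto_atTop]
  intro ε hε
  have hexp := (Complex.continuous_exp.tendsto _).comp hint
  obtain ⟨k, hk1, hk2⟩ := ((Metric.tendsto_nhds.1 hexp (ε / 3) (by positivity)).and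
    (Metric.tendsto_nhds.1 hreal (ε / 3) (by positivity))).exists
  obtain ⟨n₀, hn₀⟩ := Metric.tendsto_atTop.1
    (tendsto_integral_prod_one_add_simpleFunc hx hP (s k) (hsi k) (hsB k)) (ε / 3) (by positivity)
  refine ⟨n₀, fun n hn ↦ ?_⟩
  have h1 := hn₀ n hn
  have h2 := hdiff k n
  rw [← dist_eq_norm] at h2
  rw [Real.dist_eq, sub_zero] at hk2
  have h3 := le_abs_self (∫ y, ‖s k y - (g y - 1)‖)
  have h4 := dist_triangle4 (∫ ω, ∏ i ∈ Finset.range n, g (x i ω) ∂P)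
    (∫ ω, ∏ i ∈ Finset.range n, (1 + s k (x i ω)) ∂P) (Complex.exp (∫ y, s k y))
    (Complex.exp (∫ y, (g y - 1)))
  simp only [Function.comp_apply] at hk1
  linarith

end PoissonStart

/-- The points `x i` of a Poisson point process with Lebesgue intensity carry independent marks
`ζ i` with common law `Q`, and the marks are independent of the points. -/
structure IsMarkedPoisson {Ω M : Type*} [MeasurableSpace Ω] [MeasurableSpace M]
    (x : ℕ → Ω → ℝ) (ζ : ℕ → Ω → M) (Q : Measure M) (P : Measure Ω) : Prop where
  measurable_start : ∀ i, Measurable (x i)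
  poisson_start : IsPoissonRandomMeasure
    (fun ω ↦ Measure.sum (fun i ↦ Measure.dirac (x i ω))) (volume : Measure ℝ) P
  measurable_mark : ∀ i, Measurable (ζ i)
  map_mark : ∀ i, P.map (ζ i) = Q
  indep_marks : iIndepFun ζ P
  indep_start_marks : IndepFun (fun ω i ↦ x i ω) (fun ω i ↦ ζ i ω) P

namespace IsMarkedPoisson

variable {Ω M : Type*} [MeasurableSpace Ω] [MeasurableSpace M] {P : Measure Ω}
  [IsProbabilityMeasure P] {x : ℕ → Ω → ℝ} {ζ : ℕ → Ω → M} {Q : Measure M}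

theorem isProbabilityMeasure_mark (h : IsMarkedPoisson x ζ Q P) : IsProbabilityMeasure Q := by
  rw [← h.map_mark 0]
  exact Measure.isProbabilityMeasure_map (h.measurable_mark 0).aemeasurable

theorem map_point_mark (h : IsMarkedPoisson x ζ Q P) (i : ℕ) :
    P.map (fun ω ↦ (x i ω, ζ i ω)) = (P.map (x i)).prod Q := by
  have hi : IndepFun (x i) (ζ i) P := h.indep_start_marks.comp
    (measurable_pi_apply i) (measurable_pi_apply i)
  rw [← h.map_mark i]
  exact (indepFun_iff_map_prod_eq_prod_map_map (h.measurable_start i).aemeasurable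
    (h.measurable_mark i).aemeasurable).1 hi

/-- The intensity measure of the marked process is the product measure. -/
theorem sum_map_eq_prod (h : IsMarkedPoisson x ζ Q P) :
    Measure.sum (fun i ↦ P.map (fun ω ↦ (x i ω, ζ i ω))) = (volume : Measure ℝ).prod Q := by
  have := h.isProbabilityMeasure_mark
  simp_rw [h.map_point_mark]
  rw [← Measure.prod_sum_left, sum_map_eq_volume h.measurable_start h.poisson_start]

omit [IsProbabilityMeasure P] in
theorem measurable_point_mark (h : IsMarkedPoisson x ζ Q P) (i : ℕ) :
    Measurable (fun ω ↦ (x i ω, ζ i ω)) :=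
  (h.measurable_start i).prodMk (h.measurable_mark i)

/-- **Campbell's formula** for nonnegative functions. -/
theorem lintegral_tsum_eq (h : IsMarkedPoisson x ζ Q P) {f : ℝ × M → ℝ≥0∞} (hf : Measurable f) :
    ∫⁻ ω, ∑' i, f (x i ω, ζ i ω) ∂P = ∫⁻ p, f p ∂((volume : Measure ℝ).prod Q) := by
  have hm : ∀ i, Measurable fun ω ↦ f (x i ω, ζ i ω) := fun i ↦
    hf.comp (h.measurable_point_mark i)
  rw [lintegral_tsum fun i ↦ (hm i).aemeasurable, ← h.sum_map_eq_prod, lintegral_sum_measure]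
  congr with i
  rw [lintegral_map hf (h.measurable_point_mark i)]

theorem ae_summable_norm (h : IsMarkedPoisson x ζ Q P) {F : ℝ × M → ℝ} (hF : Measurable F)
    (hFi : Integrable F ((volume : Measure ℝ).prod Q)) :
    ∀ᵐ ω ∂P, Summable (fun i ↦ |F (x i ω, ζ i ω)|) := by
  have h1 := h.lintegral_tsum_eq (f := fun p ↦ ‖F p‖ₑ) hF.enorm
  have h2 : ∫⁻ ω, ∑' i, ‖F (x i ω, ζ i ω)‖ₑ ∂P ≠ ∞ := by
    rw [h1]; exact hFi.2.ne
  filter_upwards [ae_lt_top (Measurable.tsum fun i ↦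
    (hF.comp (h.measurable_point_mark i)).enorm) h2] with ω hω
  have := ENNReal.summable_toReal hω.ne
  exact this.congr fun i ↦ by simp

/-- Campbell's formula for integrable functions. -/
theorem integrable_tsum_and_integral_tsum (h : IsMarkedPoisson x ζ Q P) {F : ℝ × M → ℝ}
    (hF : Measurable F) (hFi : Integrable F ((volume : Measure ℝ).prod Q)) :
    Integrable (fun ω ↦ ∑' i, F (x i ω, ζ i ω)) P ∧
      ∫ ω, ∑' i, F (x i ω, ζ i ω) ∂P = ∫ p, F p ∂((volume : Measure ℝ).prod Q) := by
  have hFs : Integrable F (Measure.sum fun i ↦ P.map (fun ω ↦ (x i ω, ζ i ω))) := by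
    rw [h.sum_map_eq_prod]; exact hFi
  have hm : ∀ i, AEStronglyMeasurable (fun ω ↦ F (x i ω, ζ i ω)) P := fun i ↦
    (hF.comp (h.measurable_point_mark i)).aestronglyMeasurable
  have hfin : ∑' i, ∫⁻ ω, ‖F (x i ω, ζ i ω)‖ₑ ∂P ≠ ∞ := by
    rw [← lintegral_tsum fun i ↦ (hm i).enorm]
    rw [h.lintegral_tsum_eq (f := fun p ↦ ‖F p‖ₑ) hF.enorm]
    exact hFi.2.ne
  refine ⟨⟨?_, ?_⟩, ?_⟩
  · exact (Measurable.tsum fun i ↦ hF.comp (h.measurable_point_mark i)).aestronglyMeasurable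
  · rw [hasFiniteIntegral_iff_enorm]
    refine lt_of_le_of_lt (lintegral_mono (g := fun ω ↦ ∑' i, ‖F (x i ω, ζ i ω)‖ₑ) fun ω ↦ ?_) ?_
    · exact enorm_tsum_le_tsum_enorm
    · rw [h.lintegral_tsum_eq (f := fun p ↦ ‖F p‖ₑ) hF.enorm]
      exact hFi.2
  · rw [integral_tsum hm hfin, ← h.sum_map_eq_prod, integral_sum_measure hFs]
    congr with i
    rw [integral_map (h.measurable_point_mark i).aemeasurable hF.aestronglyMeasurable]

/-- Conditionally on the points, the marks are independent with law `Q`. -/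
theorem integral_prod_exp (h : IsMarkedPoisson x ζ Q P) {F : ℝ × M → ℝ} (hF : Measurable F)
    (n : ℕ) :
    ∫ ω, ∏ i ∈ Finset.range n, Complex.exp (F (x i ω, ζ i ω) * Complex.I) ∂P =
      ∫ ω, ∏ i ∈ Finset.range n, (∫ z, Complex.exp (F (x i ω, z) * Complex.I) ∂Q) ∂P := by
  have := h.isProbabilityMeasure_mark
  set X : Ω → Fin n → ℝ := fun ω i ↦ x i ω with hX
  set Y : Ω → Fin n → M := fun ω i ↦ ζ i ω with hY
  have hXm : Measurable X := measurable_pi_lambda _ fun i ↦ h.measurable_start i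
  have hYm : Measurable Y := measurable_pi_lambda _ fun i ↦ h.measurable_mark i
  have hXY : IndepFun X Y P := h.indep_start_marks.comp
    (φ := fun (u : ℕ → ℝ) (i : Fin n) ↦ u i) (ψ := fun (u : ℕ → M) (i : Fin n) ↦ u i)
    (measurable_pi_lambda _ fun i ↦ measurable_pi_apply _)
    (measurable_pi_lambda _ fun i ↦ measurable_pi_apply _)
  have hYlaw : P.map Y = Measure.pi (fun _ : Fin n ↦ Q) := by
    have h1 := (iIndepFun_iff_map_fun_eq_pi_map
      (fun i : Fin n ↦ (h.measurable_mark i).aemeasurable)).1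
      (h.indep_marks.precomp (g := fun i : Fin n ↦ (i : ℕ)) Fin.val_injective)
    simp_rw [h.map_mark] at h1
    exact h1
  have hjoint := (indepFun_iff_map_prod_eq_prod_map_map hXm.aemeasurable hYm.aemeasurable).1 hXY
  have hXp : IsProbabilityMeasure (P.map X) := Measure.isProbabilityMeasure_map hXm.aemeasurable
  set Φ : (Fin n → ℝ) × (Fin n → M) → ℂ :=
    fun p ↦ ∏ i, Complex.exp (F (p.1 i, p.2 i) * Complex.I) with hΦ
  have hΦm : Measurable Φ := by
    refine Finset.measurable_fun_prod _ fun i _ ↦ ?_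
    have h1 : Measurable fun p : (Fin n → ℝ) × (Fin n → M) ↦ F (p.1 i, p.2 i) :=
      hF.comp (((measurable_pi_apply i).comp measurable_fst).prodMk
        ((measurable_pi_apply i).comp measurable_snd))
    fun_prop
  have hΦb : ∀ p, ‖Φ p‖ ≤ 1 := fun p ↦ by
    rw [hΦ, norm_prod]
    exact Finset.prod_le_one (fun i _ ↦ norm_nonneg _)
      fun i _ ↦ (Complex.norm_exp_ofReal_mul_I _).le
  have hgm : Measurable fun y ↦ ∫ z, Complex.exp (F (y, z) * Complex.I) ∂Q := by
    have : StronglyMeasurable fun p : ℝ × M ↦ Complex.exp (F p * Complex.I) :=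
      Measurable.stronglyMeasurable (by fun_prop)
    exact this.integral_prod_right.measurable
  calc _ = ∫ ω, Φ (X ω, Y ω) ∂P := by
        simp only [hΦ, hX, hY, Finset.prod_range]
    _ = ∫ p, Φ p ∂((P.map X).prod (Measure.pi fun _ : Fin n ↦ Q)) := by
        rw [← hYlaw, ← hjoint,
          integral_map (hXm.prodMk hYm).aemeasurable hΦm.aestronglyMeasurable]
    _ = ∫ u, ∏ i, (∫ z, Complex.exp (F (u i, z) * Complex.I) ∂Q) ∂(P.map X) := by
        rw [integral_prod]
        · congr with u
          exact integral_fintype_prod_eq_prod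
            (fun i z ↦ Complex.exp (F (u i, z) * Complex.I))
        · exact (integrable_const (1 : ℝ)).mono' hΦm.aestronglyMeasurable (ae_of_all _ hΦb)
    _ = _ := by
        rw [integral_map hXm.aemeasurable]
        · simp only [hX, Finset.prod_range]
        · exact (Finset.measurable_fun_prod _ fun i _ ↦
            hgm.comp (measurable_pi_apply i)).aestronglyMeasurable

/-- The characteristic functional of a marked Poisson process. -/
theorem integral_exp_tsum (h : IsMarkedPoisson x ζ Q P) {F : ℝ × M → ℝ} (hF : Measurable F)
    (hFi : Integrable F ((volume : Measure ℝ).prod Q)) :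
    ∫ ω, Complex.exp ((∑' i, F (x i ω, ζ i ω) : ℝ) * Complex.I) ∂P =
      Complex.exp (∫ p, (Complex.exp (F p * Complex.I) - 1) ∂((volume : Measure ℝ).prod Q)) := by
  have := h.isProbabilityMeasure_mark
  have hEm : Measurable fun p : ℝ × M ↦ Complex.exp (F p * Complex.I) := by fun_prop
  have hEi : Integrable (fun p : ℝ × M ↦ Complex.exp (F p * Complex.I) - 1)
      ((volume : Measure ℝ).prod Q) := by
    refine hFi.abs.mono' (hEm.sub_const 1).aestronglyMeasurable (ae_of_all _ fun p ↦ ?_)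
    have := norm_exp_mul_I_sub_exp_mul_I_le (F p) 0
    simpa using this
  set g : ℝ → ℂ := fun y ↦ ∫ z, Complex.exp (F (y, z) * Complex.I) ∂Q with hg
  have hgm : Measurable g := hEm.stronglyMeasurable.integral_prod_right.measurable
  have hg1 : ∀ y, ‖g y‖ ≤ 1 := fun y ↦ by
    have := norm_integral_le_of_norm_le_const (μ := Q) (C := 1)
      (f := fun z ↦ Complex.exp (F (y, z) * Complex.I))
      (ae_of_all _ fun z ↦ (Complex.norm_exp_ofReal_mul_I _).le)
    simpa using this
  have hgsub : ∀ y, g y - 1 = ∫ z, (Complex.exp (F (y, z) * Complex.I) - 1) ∂Q := fun y ↦ by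
    have hm : Measurable fun z ↦ F (y, z) := hF.comp measurable_prodMk_left
    rw [integral_sub (integrable_exp_mul_I hm.aestronglyMeasurable) (integrable_const _)]
    simp [hg]
  have hgi : Integrable (fun y ↦ g y - 1) := by
    simp_rw [hgsub]
    exact hEi.integral_prod_left
  have hpois := tendsto_integral_prod_poisson h.measurable_start h.poisson_start g hgm hg1 hgi
  have hlim : Tendsto (fun n ↦ ∫ ω, ∏ i ∈ Finset.range n,
      Complex.exp (F (x i ω, ζ i ω) * Complex.I) ∂P) atTop
      (𝓝 (∫ ω, Complex.exp ((∑' i, F (x i ω, ζ i ω) : ℝ) * Complex.I) ∂P)) := by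
    refine tendsto_integral_of_dominated_convergence (fun _ ↦ (1 : ℝ)) (fun n ↦ ?_)
      (integrable_const _) (fun n ↦ ae_of_all _ fun ω ↦ ?_) ?_
    · exact (Finset.measurable_fun_prod _ fun i _ ↦
        hEm.comp (h.measurable_point_mark i)).aestronglyMeasurable
    · rw [norm_prod]
      exact Finset.prod_le_one (fun i _ ↦ norm_nonneg _)
        fun i _ ↦ (Complex.norm_exp_ofReal_mul_I _).le
    · filter_upwards [h.ae_summable_norm hF hFi] with ω hω
      have h1 := hω.of_abs.hasSum.tendsto_sum_nat
      have hc : Continuous fun y : ℝ ↦ Complex.exp (y * Complex.I) := by fun_prop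
      refine ((hc.tendsto _).comp h1).congr fun n ↦ ?_
      rw [Function.comp_apply, ← Complex.exp_sum]
      push_cast
      rw [Finset.sum_mul]
  simp_rw [h.integral_prod_exp hF] at hlim
  rw [tendsto_nhds_unique hlim hpois, integral_prod _ hEi]
  simp_rw [hgsub]

end IsMarkedPoisson

/-! ### Stable paths as random elements of the product space -/

/-- The grid point of mesh `1 / (n + 1)` that follows `t`. -/
noncomputable def gridAfter (n : ℕ) (t : ℝ≥0) : ℝ≥0 :=
  ((⌊((n : ℝ≥0) + 1) * t⌋₊ : ℝ≥0) + 1) / ((n : ℝ≥0) + 1)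

theorem le_gridAfter (n : ℕ) (t : ℝ≥0) : t ≤ gridAfter n t := by
  rw [gridAfter, le_div_iff₀ (by positivity), mul_comm]
  exact (Nat.lt_floor_add_one _).le

theorem gridAfter_le (n : ℕ) (t : ℝ≥0) : gridAfter n t ≤ t + 1 / ((n : ℝ≥0) + 1) := by
  have h : (⌊((n : ℝ≥0) + 1) * t⌋₊ : ℝ≥0) ≤ ((n : ℝ≥0) + 1) * t := Nat.floor_le (by positivity)
  rw [gridAfter, div_le_iff₀ (by positivity), add_mul t, one_div,
    inv_mul_cancel₀ (by positivity), mul_comm t]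
  gcongr

theorem tendsto_gridAfter (t : ℝ≥0) : Tendsto (fun n ↦ gridAfter n t) atTop (𝓝[≥] t) := by
  refine tendsto_nhdsWithin_iff.2 ⟨?_, Eventually.of_forall fun n ↦ le_gridAfter n t⟩
  have h : Tendsto (fun n : ℕ ↦ t + 1 / ((n : ℝ≥0) + 1)) atTop (𝓝 (t + 0)) :=
    tendsto_const_nhds.add tendsto_one_div_add_atTop_nhds_zero_nat
  rw [add_zero] at h
  exact tendsto_of_tendsto_of_tendsto_of_le_of_le tendsto_const_nhds h (fun n ↦ le_gridAfter n t)
    fun n ↦ gridAfter_le n t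

/-- The right limit of a path at time `t⁺`, computed along rational times. It is jointly measurable
in time and path for the product `σ`-algebra on the path space, and recovers the values of a right
continuous path. The junk value of `limUnder` is used for paths without this limit. -/
noncomputable def rightLimit (t : ℝ) (z : ℝ≥0 → ℝ) : ℝ :=
  limUnder atTop (fun n ↦ z (gridAfter n t.toNNReal))

theorem rightLimit_eq {z : ℝ≥0 → ℝ} {t : ℝ}
    (hz : ContinuousWithinAt z (Set.Ici t.toNNReal) t.toNNReal) :
    rightLimit t z = z t.toNNReal :=
  (hz.tendsto.comp (tendsto_gridAfter t.toNNReal)).limUnder_eq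

theorem measurable_rightLimit : Measurable (fun p : ℝ × (ℝ≥0 → ℝ) ↦ rightLimit p.1 p.2) := by
  have h : ∀ n : ℕ, Measurable (fun p : ℝ × (ℝ≥0 → ℝ) ↦ p.2 (gridAfter n p.1.toNNReal)) := by
    intro n
    have h1 : Measurable (fun q : (ℝ≥0 → ℝ) × ℕ ↦ q.1 (((q.2 : ℝ≥0) + 1) / ((n : ℝ≥0) + 1))) :=
      measurable_from_prod_countable_left fun k ↦
        measurable_pi_apply (((k : ℝ≥0) + 1) / ((n : ℝ≥0) + 1))
    exact h1.comp (measurable_snd.prodMk (Nat.measurable_floor.comp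
      (measurable_fst.real_toNNReal.const_mul ((n : ℝ≥0) + 1))))
  exact (StronglyMeasurable.limUnder fun n ↦ (h n).stronglyMeasurable).measurable

/-- The properties of a measurable process `W`, indexed by the nonnegative reals, under the
probability measure `Q`, on which the fluctuation asymptotics depend: the increments over
consecutive intervals are independent and symmetric `α`-stable. -/
structure IsStableFlow {M : Type*} [MeasurableSpace M] (α : ℝ) (W : ℝ → M → ℝ)
    (Q : Measure M) : Prop where
  measurable : Measurable (fun p : ℝ × M ↦ W p.1 p.2)
  charFun_increment : ∀ s t : ℝ, 0 ≤ s → s ≤ t → ∀ y : ℝ,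
    charFun (Q.map (fun z ↦ W t z - W s z)) y = Complex.exp ((-((t - s) * |y| ^ α) : ℝ) : ℂ)
  indep_increments : ∀ r s t : ℝ, 0 ≤ r → r ≤ s → s ≤ t →
    IndepFun (fun z ↦ W s z - W r z) (fun z ↦ W t z - W s z) Q

namespace IsStableLevyMotion

variable {Ω : Type*} [MeasurableSpace Ω] {P : Measure Ω} [IsProbabilityMeasure P] {α : ℝ}
  {X Y : ℝ≥0 → Ω → ℝ}

omit [IsProbabilityMeasure P] in
theorem measurable_path (hX : IsStableLevyMotion α X P) : Measurable (fun ω s ↦ X s ω) :=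
  measurable_pi_lambda _ hX.measurable

/-- Finite-dimensional laws of two stable motions agree, since the values are sums of independent
increments with prescribed laws. -/
theorem map_path_eq (hX : IsStableLevyMotion α X P) (hY : IsStableLevyMotion α Y P) :
    P.map (fun ω s ↦ X s ω) = P.map (fun ω s ↦ Y s ω) := by
  refine (map_eq_iff_forall_finset_map_restrict_eq hX.measurable_path.aemeasurable
    hY.measurable_path.aemeasurable).2 fun I ↦ ?_
  set t : Fin (I.card + 1) → ℝ≥0 := Fin.cons 0 (I.orderEmbOfFin rfl) with ht
  have htm : Monotone t := by
    intro i j hij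
    induction i using Fin.cases with
    | zero => simp [ht]
    | succ i =>
      induction j using Fin.cases with
      | zero => simp at hij
      | succ j => simpa [ht] using hij
  set L : (Fin I.card → ℝ) → (I → ℝ) :=
    fun y i ↦ ∑ j ∈ Finset.Iic ((I.orderIsoOfFin rfl).symm i), y j with hL
  have hLm : Measurable L := by
    refine measurable_pi_lambda _ fun i ↦ Finset.measurable_fun_sum _ fun j _ ↦
      measurable_pi_apply j
  have key : ∀ {V : ℝ≥0 → Ω → ℝ}, IsStableLevyMotion α V P →
      P.map (fun ω ↦ I.restrict (V · ω)) = (Measure.pi fun i : Fin I.card ↦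
        P.map (fun ω ↦ V (t i.succ) ω - V (t i.castSucc) ω)).map L := by
    intro V hV
    have h1 := (iIndepFun_iff_map_fun_eq_pi_map (fun i : Fin I.card ↦
      ((hV.measurable (t i.succ)).sub (hV.measurable (t i.castSucc))).aemeasurable)).1
      (hV.indep_increments I.card t htm)
    refine Eq.trans ?_ (congrArg (Measure.map L) h1)
    rw [Measure.map_map hLm (measurable_pi_lambda _ fun i : Fin I.card ↦
      (hV.measurable (t i.succ)).sub (hV.measurable (t i.castSucc)))]
    refine Measure.map_congr ?_
    filter_upwards [hV.start_zero] with ω hω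
    ext i
    simp only [hL, Function.comp_apply, Finset.restrict, Pi.sub_apply]
    rw [Fin.sum_Iic_sub _ (fun j ↦ V (t j) ω)]
    have h2 : t ((I.orderIsoOfFin rfl).symm i).succ = i := by
      simp only [ht, Fin.cons_succ]
      rw [← Finset.coe_orderIsoOfFin_apply, OrderIso.apply_symm_apply]
    rw [h2]
    simp [ht, hω]
  rw [key hX, key hY]
  congr 2
  ext1 i
  have hXm := (hX.measurable (t i.succ)).sub (hX.measurable (t i.castSucc))
  have hYm := (hY.measurable (t i.succ)).sub (hY.measurable (t i.castSucc))
  have := Measure.isProbabilityMeasure_map (μ := P) hXm.aemeasurable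
  have := Measure.isProbabilityMeasure_map (μ := P) hYm.aemeasurable
  refine Measure.ext_of_charFun (funext fun y ↦ ?_)
  have hle : t i.castSucc ≤ t i.succ := htm (Fin.castSucc_le_succ i)
  exact (hX.charFun_increment _ _ hle y).trans (hY.charFun_increment _ _ hle y).symm

omit [IsProbabilityMeasure P] in
theorem ae_rightLimit_eq (hX : IsStableLevyMotion α X P) :
    ∀ᵐ ω ∂P, ∀ s : ℝ, rightLimit s (fun t ↦ X t ω) = X s.toNNReal ω := by
  filter_upwards [hX.cadlag] with ω hω s
  exact rightLimit_eq (hω s.toNNReal).1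

theorem isStableFlow (hX : IsStableLevyMotion α X P) :
    IsStableFlow α rightLimit (P.map (fun ω s ↦ X s ω)) := by
  have hm : ∀ s, Measurable (rightLimit s) := fun s ↦
    measurable_rightLimit.comp measurable_prodMk_left
  have hmap : ∀ s t : ℝ, 0 ≤ s → s ≤ t →
      (fun z ↦ rightLimit t z - rightLimit s z) ∘ (fun ω u ↦ X u ω) =ᵐ[P]
        fun ω ↦ X t.toNNReal ω - X s.toNNReal ω := by
    intro s t _ _
    filter_upwards [hX.ae_rightLimit_eq] with ω hω
    simp only [Function.comp_apply, hω]
  have hmd : ∀ s t, Measurable (fun z ↦ rightLimit t z - rightLimit s z) := fun s t ↦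
    (hm t).sub (hm s)
  refine ⟨measurable_rightLimit, fun s t hs hst y ↦ ?_, fun r s t hr hrs hst ↦ ?_⟩
  · rw [Measure.map_map (hmd s t) hX.measurable_path, Measure.map_congr (hmap s t hs hst),
      hX.charFun_increment _ _ (Real.toNNReal_le_toNNReal hst), Real.coe_toNNReal _ hs,
      Real.coe_toNNReal _ (hs.trans hst)]
  · have hs := hr.trans hrs
    have := Measure.isProbabilityMeasure_map (μ := P) hX.measurable_path.aemeasurable
    have h1 := hX.indep_increments.indepFun_sub_sub (Real.toNNReal_le_toNNReal hrs)
      (Real.toNNReal_le_toNNReal hst)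
    have h2 := h1.congr (hmap r s hr hrs).symm (hmap s t hs hst).symm
    have hm1 := hmd r s
    have hm2 := hmd s t
    rw [indepFun_iff_map_prod_eq_prod_map_map (hm1.comp hX.measurable_path).aemeasurable
      (hm2.comp hX.measurable_path).aemeasurable, ← Measure.map_map hm1 hX.measurable_path,
      ← Measure.map_map hm2 hX.measurable_path] at h2
    rw [indepFun_iff_map_prod_eq_prod_map_map hm1.aemeasurable hm2.aemeasurable]
    exact (Measure.map_map (hm1.prodMk hm2) hX.measurable_path).trans h2

end IsStableLevyMotion

/-- A Poisson system of stable particles is a Poisson process of points marked by paths. -/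
theorem IsPoissonStableSystem.isMarkedPoisson {Ω : Type*} [MeasurableSpace Ω] {P : Measure Ω}
    [IsProbabilityMeasure P] {α : ℝ} {x : ℕ → Ω → ℝ} {Z : ℕ → ℝ≥0 → Ω → ℝ}
    (h : IsPoissonStableSystem α x Z P) :
    IsMarkedPoisson x (fun i ω s ↦ Z i s ω) (P.map (fun ω s ↦ Z 0 s ω)) P where
  measurable_start := h.measurable_start
  poisson_start := h.poisson_start
  measurable_mark i := (h.stable_motion i).measurable_path
  map_mark i := (h.stable_motion i).map_path_eq (h.stable_motion 0)
  indep_marks := h.indep_motions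
  indep_start_marks := h.indep_start_motions

/-! ### The potential of the stable semigroup -/

/-- The function `u ↦ ∫ f(x) exp(-u |x| ^ α) dx`. If `f` is the Fourier transform of a correlation
function, this is its expectation at an increment of the stable motion over a time `u`. -/
noncomputable def stableLaplace (α : ℝ) (f : ℝ → ℝ) (u : ℝ) : ℝ :=
  ∫ x, f x * Real.exp (-(u * |x| ^ α))

section StableLaplace

variable {α : ℝ} {f : ℝ → ℝ}

theorem integrable_stableLaplace_integrand (hf0 : ∀ x, 0 ≤ f x) (hf : Measurable f)
    (hfα : Integrable (fun x ↦ f x * (1 / |x| ^ α))) :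
    Integrable (fun p : ℝ × ℝ ↦ f p.2 * Real.exp (-(p.1 * |p.2| ^ α)))
      ((volume.restrict (Set.Ioi 0)).prod volume) := by
  have hm : Measurable (fun p : ℝ × ℝ ↦ f p.2 * Real.exp (-(p.1 * |p.2| ^ α))) := by fun_prop
  have hae : ∀ᵐ x : ℝ, x ≠ 0 := by simp [ae_iff]
  refine (integrable_prod_iff' hm.aestronglyMeasurable).2 ⟨?_, ?_⟩
  · filter_upwards [hae] with x hx
    have h := integrableOn_exp_mul_Ioi (a := -|x| ^ α) (by simp only [neg_lt_zero]; positivity) 0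
    refine (h.const_mul (f x)).congr (ae_of_all _ fun u ↦ ?_)
    simp only
    congr 2
    ring
  · refine hfα.congr ?_
    filter_upwards [hae] with x hx
    have h := integral_exp_mul_Ioi (a := -|x| ^ α) (by simp only [neg_lt_zero]; positivity) 0
    simp only [norm_mul, Real.norm_eq_abs, abs_of_nonneg (hf0 x), Real.abs_exp]
    rw [integral_const_mul]
    congr 1
    have : ∀ u : ℝ, Real.exp (-(u * |x| ^ α)) = Real.exp (-|x| ^ α * u) := fun u ↦ by ring_nf
    simp_rw [this, h]
    simp [neg_div_neg_eq]

theorem integrableOn_stableLaplace (hf0 : ∀ x, 0 ≤ f x) (hf : Measurable f)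
    (hfα : Integrable (fun x ↦ f x * (1 / |x| ^ α))) :
    IntegrableOn (stableLaplace α f) (Set.Ioi 0) :=
  (integrable_stableLaplace_integrand hf0 hf hfα).integral_prod_left

theorem integral_stableLaplace (hf0 : ∀ x, 0 ≤ f x) (hf : Measurable f)
    (hfα : Integrable (fun x ↦ f x * (1 / |x| ^ α))) :
    ∫ u in Set.Ioi 0, stableLaplace α f u = ∫ x, f x * (1 / |x| ^ α) := by
  unfold stableLaplace
  rw [integral_integral_swap (integrable_stableLaplace_integrand hf0 hf hfα)]
  refine integral_congr_ae ?_
  have hae : ∀ᵐ x : ℝ, x ≠ 0 := by simp [ae_iff]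
  filter_upwards [hae] with x hx
  have h := integral_exp_mul_Ioi (a := -|x| ^ α) (by simp only [neg_lt_zero]; positivity) 0
  rw [integral_const_mul]
  congr 1
  have : ∀ u : ℝ, Real.exp (-(u * |x| ^ α)) = Real.exp (-|x| ^ α * u) := fun u ↦ by ring_nf
  simp_rw [this, h]
  simp [neg_div_neg_eq]

end StableLaplace

/-- Time averages of a stationary correlation: the double integral of `k |r - s|` over a square of
side `T` grows like `2 T ∫ k`. -/
theorem tendsto_average_correlation {k : ℝ → ℝ} (hk : IntegrableOn k (Set.Ioi 0)) :
    Tendsto (fun T : ℝ ↦ (1 / T) * ∫ s in Set.Ioc 0 T, ∫ r in Set.Ioc 0 T, k |r - s|) atTop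
      (𝓝 (2 * ∫ u in Set.Ioi 0, k u)) := by
  set K : ℝ → ℝ := fun s ↦ ∫ u in (0 : ℝ)..s, k u with hK
  have hki : ∀ a b : ℝ, 0 ≤ a → a ≤ b → IntervalIntegrable k volume a b := fun a b ha hab ↦
    (intervalIntegrable_iff_integrableOn_Ioc_of_le hab).2
      (hk.mono_set fun y hy ↦ ha.trans_lt hy.1)
  have hinner : ∀ T s : ℝ, 0 ≤ s → s ≤ T →
      ∫ r in Set.Ioc 0 T, k |r - s| = K s + K (T - s) := by
    intro T s hs hsT
    rw [← intervalIntegral.integral_of_le (hs.trans hsT)]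
    have e1 : Set.EqOn (fun r ↦ k (s - r)) (fun r ↦ k |r - s|) (Set.uIcc 0 s) := by
      intro r hr
      rw [Set.uIcc_of_le hs] at hr
      simp only
      rw [abs_sub_comm, abs_of_nonneg (sub_nonneg.2 hr.2)]
    have e2 : Set.EqOn (fun r ↦ k (r - s)) (fun r ↦ k |r - s|) (Set.uIcc s T) := by
      intro r hr
      rw [Set.uIcc_of_le hsT] at hr
      simp only
      rw [abs_of_nonneg (sub_nonneg.2 hr.1)]
    have i1 : IntervalIntegrable (fun r ↦ k |r - s|) volume 0 s := by
      have := ((hki 0 s le_rfl hs).comp_sub_left s).symm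
      simp only [sub_zero, sub_self] at this
      exact this.congr (e1.mono Set.uIoc_subset_uIcc)
    have i2 : IntervalIntegrable (fun r ↦ k |r - s|) volume s T := by
      have := (hki 0 (T - s) le_rfl (by linarith)).comp_sub_right s
      simp only [zero_add, sub_add_cancel] at this
      exact this.congr (e2.mono Set.uIoc_subset_uIcc)
    rw [← intervalIntegral.integral_add_adjacent_intervals i1 i2,
      ← intervalIntegral.integral_congr e1, ← intervalIntegral.integral_congr e2,
      intervalIntegral.integral_comp_sub_left, intervalIntegral.integral_comp_sub_right]
    simp [hK]
  have hKc : ContinuousOn K (Set.Ici 0) := by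
    intro s hs
    have h1 : IntegrableOn k (Set.uIcc 0 (s + 1)) := by
      rw [Set.uIcc_of_le (by have : (0 : ℝ) ≤ s := hs; linarith),
        integrableOn_Icc_iff_integrableOn_Ioc]
      exact hk.mono_set fun y hy ↦ hy.1
    have h2 := intervalIntegral.continuousOn_primitive_interval h1
    rw [Set.uIcc_of_le (by have : (0 : ℝ) ≤ s := hs; linarith)] at h2
    refine (h2 s ⟨hs, by linarith⟩).mono_of_mem_nhdsWithin ?_
    have : Set.Ici (0 : ℝ) ∩ Set.Iio (s + 1) ∈ 𝓝[Set.Ici 0] s :=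
      inter_mem self_mem_nhdsWithin (mem_nhdsWithin_of_mem_nhds (Iio_mem_nhds (by linarith)))
    exact mem_of_superset this fun y hy ↦ ⟨hy.1, hy.2.le⟩
  have houter : ∀ T : ℝ, 0 < T →
      (1 / T) * ∫ s in Set.Ioc 0 T, ∫ r in Set.Ioc 0 T, k |r - s| =
        2 * ∫ a in (0 : ℝ)..1, K (T * a) := by
    intro T hT
    have hKi : IntervalIntegrable K volume 0 T := by
      refine ContinuousOn.intervalIntegrable (hKc.mono ?_)
      rw [Set.uIcc_of_le hT.le]
      exact fun y hy ↦ hy.1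
    have hKi' : IntervalIntegrable (fun s ↦ K (T - s)) volume 0 T := by
      have := (hKi.comp_sub_left T).symm
      simpa using this
    rw [setIntegral_congr_fun measurableSet_Ioc fun s hs ↦ hinner T s hs.1.le hs.2,
      ← intervalIntegral.integral_of_le hT.le, intervalIntegral.integral_add hKi hKi',
      intervalIntegral.integral_comp_sub_left, intervalIntegral.integral_comp_mul_left _ hT.ne']
    simp only [sub_self, sub_zero, mul_zero, mul_one, smul_eq_mul]
    field_simp
    ring
  have hKb : ∀ s, 0 ≤ s → |K s| ≤ ∫ u in Set.Ioi 0, |k u| := by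
    intro s hs
    change |∫ u in (0 : ℝ)..s, k u| ≤ _
    rw [intervalIntegral.integral_of_le hs]
    refine (norm_integral_le_integral_norm (f := k) (μ := volume.restrict (Set.Ioc 0 s))).trans ?_
    exact setIntegral_mono_set hk.norm (ae_of_all _ fun _ ↦ norm_nonneg _)
      (Eventually.of_forall fun y hy ↦ hy.1)
  have hlim : Tendsto (fun T : ℝ ↦ ∫ a in (0 : ℝ)..1, K (T * a)) atTop
      (𝓝 (∫ _ in (0 : ℝ)..1, ∫ u in Set.Ioi 0, k u)) := by
    refine intervalIntegral.tendsto_integral_filter_of_dominated_convergence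
      (fun _ ↦ ∫ u in Set.Ioi 0, |k u|) ?_ ?_ (by simp) ?_
    · filter_upwards [eventually_gt_atTop 0] with T hT
      rw [Set.uIoc_of_le zero_le_one]
      refine ContinuousOn.aestronglyMeasurable ?_ measurableSet_Ioc
      exact hKc.comp (by fun_prop) fun a ha ↦ mul_nonneg hT.le ha.1.le
    · filter_upwards [eventually_gt_atTop 0] with T hT
      refine ae_of_all _ fun a ha ↦ ?_
      rw [Set.uIoc_of_le zero_le_one] at ha
      exact hKb _ (mul_nonneg hT.le ha.1.le)
    · refine ae_of_all _ fun a ha ↦ ?_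
      rw [Set.uIoc_of_le zero_le_one] at ha
      exact (intervalIntegral_tendsto_integral_Ioi 0 hk tendsto_id).comp
        (tendsto_id.atTop_mul_const ha.1)
  have h2 := hlim.const_mul 2
  rw [intervalIntegral.integral_const, sub_zero, one_smul] at h2
  refine h2.congr' ?_
  filter_upwards [eventually_gt_atTop 0] with T hT
  exact (houter T hT).symm

/-! ### First and second moments of occupation times -/

/-- A measurable function dominated by a multiple of a Gaussian function. Bounded measurable
functions with compact support are of this kind; the Gaussian bound makes the Fourier transform of
the dominating function explicit. -/
structure IsGaussianDominated (C : ℝ) (ψ : ℝ → ℝ) : Prop where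
  measurable : Measurable ψ
  bound : ∀ y, |ψ y| ≤ C * Real.exp (-(y ^ 2 / 2))

namespace IsGaussianDominated

variable {C : ℝ} {ψ : ℝ → ℝ}

theorem nonneg (h : IsGaussianDominated C ψ) : 0 ≤ C :=
  nonneg_of_mul_nonneg_left ((abs_nonneg _).trans (h.bound 0)) (Real.exp_pos _)

theorem abs_le (h : IsGaussianDominated C ψ) (y : ℝ) : |ψ y| ≤ C :=
  (h.bound y).trans (mul_le_of_le_one_right h.nonneg (Real.exp_le_one_iff.2 (by
    have := sq_nonneg y; linarith)))

theorem integrable (h : IsGaussianDominated C ψ) : Integrable ψ := by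
  have hg : Integrable (fun y : ℝ ↦ C * Real.exp (-(y ^ 2 / 2))) := by
    have := (integrable_exp_neg_mul_sq (b := 1 / 2) (by norm_num)).const_mul C
    refine this.congr (ae_of_all _ fun y ↦ ?_)
    simp only
    congr 2
    ring
  exact hg.mono' h.measurable.aestronglyMeasurable (ae_of_all _ h.bound)

theorem memLp_two (h : IsGaussianDominated C ψ) : MemLp ψ 2 := by
  rw [memLp_two_iff_integrable_sq h.measurable.aestronglyMeasurable]
  refine (h.integrable.abs.const_mul C).mono' (by have := h.measurable; fun_prop)
    (ae_of_all _ fun y ↦ ?_)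
  rw [Real.norm_eq_abs, abs_pow, sq]
  exact mul_le_mul_of_nonneg_right (h.abs_le y) (abs_nonneg _)

theorem const_mul (h : IsGaussianDominated C ψ) (a : ℝ) :
    IsGaussianDominated (|a| * C) (fun y ↦ a * ψ y) where
  measurable := h.measurable.const_mul a
  bound y := by
    rw [abs_mul, mul_assoc]
    exact mul_le_mul_of_nonneg_left (h.bound y) (abs_nonneg a)

theorem sum {ι : Type*} (s : Finset ι) {C : ι → ℝ} {ψ : ι → ℝ → ℝ}
    (h : ∀ i ∈ s, IsGaussianDominated (C i) (ψ i)) :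
    IsGaussianDominated (∑ i ∈ s, C i) (fun y ↦ ∑ i ∈ s, ψ i y) where
  measurable := Finset.measurable_fun_sum s fun i hi ↦ (h i hi).measurable
  bound y := by
    rw [Finset.sum_mul]
    exact (Finset.abs_sum_le_sum_abs _ _).trans (Finset.sum_le_sum fun i hi ↦ (h i hi).bound y)

end IsGaussianDominated

/-- The occupation time functional `∫ ψ(y + W_s) ds` over `(0, T]` of a path started at `y`. -/
noncomputable def occupationTime {M : Type*} (W : ℝ → M → ℝ) (ψ : ℝ → ℝ) (T : ℝ) (p : ℝ × M) : ℝ :=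
  ∫ s in Set.Ioc 0 T, ψ (p.1 + W s p.2)

section Moments

variable {M : Type*} [MeasurableSpace M] {Q : Measure M} [IsProbabilityMeasure Q]
  {W : ℝ → M → ℝ}

/-- Lebesgue measure is invariant for the motion. -/
theorem lintegral_comp_flow (hW : Measurable (fun p : ℝ × M ↦ W p.1 p.2)) (s : ℝ)
    {h : ℝ → ℝ≥0∞} (hh : Measurable h) :
    ∫⁻ p, h (p.1 + W s p.2) ∂((volume : Measure ℝ).prod Q) = ∫⁻ y, h y := by
  have hWs : Measurable (W s) := hW.comp measurable_prodMk_left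
  have hm : Measurable fun p : ℝ × M ↦ h (p.1 + W s p.2) :=
    hh.comp (measurable_fst.add (hWs.comp measurable_snd))
  rw [lintegral_prod_symm _ hm.aemeasurable]
  simp [lintegral_add_right_eq_self]

theorem map_flow_eq_volume (hW : Measurable (fun p : ℝ × M ↦ W p.1 p.2)) (s : ℝ) :
    MeasurePreserving (fun p : ℝ × M ↦ p.1 + W s p.2) ((volume : Measure ℝ).prod Q) volume := by
  have hWs : Measurable (W s) := hW.comp measurable_prodMk_left
  have hm : Measurable fun p : ℝ × M ↦ p.1 + W s p.2 :=
    measurable_fst.add (hWs.comp measurable_snd)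
  refine ⟨hm, Measure.ext fun A hA ↦ ?_⟩
  rw [Measure.map_apply hm hA, ← lintegral_indicator_one (hm hA), ← lintegral_indicator_one hA]
  exact lintegral_comp_flow hW s (measurable_one.indicator hA)

variable {ψ : ℝ → ℝ}

theorem measurable_comp_flow (hW : Measurable (fun p : ℝ × M ↦ W p.1 p.2)) (hψ : Measurable ψ) :
    Measurable (fun q : (ℝ × M) × ℝ ↦ ψ (q.1.1 + W q.2 q.1.2)) :=
  hψ.comp (measurable_fst.fst.add (hW.comp (measurable_snd.prodMk measurable_fst.snd)))

theorem measurable_occupationTime (hW : Measurable (fun p : ℝ × M ↦ W p.1 p.2))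
    (hψ : Measurable ψ) (T : ℝ) : Measurable (occupationTime W ψ T) :=
  (measurable_comp_flow hW hψ).stronglyMeasurable.integral_prod_right.measurable

theorem integrable_comp_flow (hW : Measurable (fun p : ℝ × M ↦ W p.1 p.2))
    (hψ : Integrable ψ) (s : ℝ) :
    Integrable (fun p : ℝ × M ↦ ψ (p.1 + W s p.2)) ((volume : Measure ℝ).prod Q) :=
  (map_flow_eq_volume hW s).integrable_comp_of_integrable hψ

theorem integral_comp_flow (hW : Measurable (fun p : ℝ × M ↦ W p.1 p.2))
    (hψ : Measurable ψ) (s : ℝ) :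
    ∫ p : ℝ × M, ψ (p.1 + W s p.2) ∂((volume : Measure ℝ).prod Q) = ∫ y, ψ y := by
  have h := integral_map (μ := (volume : Measure ℝ).prod Q)
    (map_flow_eq_volume (Q := Q) hW s).measurable.aemeasurable
    (f := ψ) hψ.aestronglyMeasurable
  rw [(map_flow_eq_volume (Q := Q) hW s).map_eq] at h
  exact h.symm

theorem integrable_comp_flow_prod (hW : Measurable (fun p : ℝ × M ↦ W p.1 p.2))
    (hψ : Measurable ψ) (hψi : Integrable ψ) (T : ℝ) :
    Integrable (fun q : (ℝ × M) × ℝ ↦ ψ (q.1.1 + W q.2 q.1.2))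
      (((volume : Measure ℝ).prod Q).prod (volume.restrict (Set.Ioc 0 T))) := by
  refine (integrable_prod_iff' (measurable_comp_flow hW hψ).aestronglyMeasurable).2
    ⟨ae_of_all _ fun s ↦ integrable_comp_flow hW hψi s, ?_⟩
  have h : ∀ s, ∫ p : ℝ × M, ‖ψ (p.1 + W s p.2)‖ ∂((volume : Measure ℝ).prod Q) = ∫ y, ‖ψ y‖ :=
    fun s ↦ integral_comp_flow hW hψ.norm s
  simp_rw [h]
  exact integrable_const _

theorem integrable_occupationTime (hW : Measurable (fun p : ℝ × M ↦ W p.1 p.2))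
    (hψ : Measurable ψ) (hψi : Integrable ψ) (T : ℝ) :
    Integrable (occupationTime W ψ T) ((volume : Measure ℝ).prod Q) :=
  (integrable_comp_flow_prod hW hψ hψi T).integral_prod_left

theorem integral_occupationTime (hW : Measurable (fun p : ℝ × M ↦ W p.1 p.2))
    (hψ : Measurable ψ) (hψi : Integrable ψ) {T : ℝ} (hT : 0 ≤ T) :
    ∫ p, occupationTime W ψ T p ∂((volume : Measure ℝ).prod Q) = T * ∫ y, ψ y := by
  unfold occupationTime
  rw [integral_integral_swap (integrable_comp_flow_prod hW hψ hψi T)]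
  simp_rw [integral_comp_flow hW hψ]
  simp [hT]

variable {α C : ℝ}

/-- The correlation of the path integrand at two times. -/
theorem integral_mul_comp_flow (hW : IsStableFlow α W Q) (hψ : IsGaussianDominated C ψ)
    {s t : ℝ} (hs : 0 ≤ s) (hst : s ≤ t) :
    ∫ p : ℝ × M, ψ (p.1 + W s p.2) * ψ (p.1 + W t p.2) ∂((volume : Measure ℝ).prod Q) =
      (2 * Real.pi)⁻¹ * stableLaplace α (fun x ↦ ‖fourierHat ψ x‖ ^ 2) (t - s) := by
  have hm : ∀ u, Measurable (W u) := fun u ↦ hW.measurable.comp measurable_prodMk_left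
  have hD : Measurable fun z ↦ W t z - W s z := (hm t).sub (hm s)
  have hi : Integrable (fun p : ℝ × M ↦ ψ (p.1 + W s p.2) * ψ (p.1 + W t p.2))
      ((volume : Measure ℝ).prod Q) := by
    refine (integrable_comp_flow hW.measurable hψ.integrable t).bdd_mul (c := C) ?_
      (ae_of_all _ fun p ↦ hψ.abs_le _)
    exact (hψ.measurable.comp
      (measurable_fst.add ((hm s).comp measurable_snd))).aestronglyMeasurable
  have hfi := integrable_norm_sq_fourierHat hψ.integrable hψ.memLp_two
  have hfm := (continuous_fourierHat hψ.integrable).measurable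
  apply Complex.ofReal_injective
  rw [integral_prod_symm _ hi, ← integral_complex_ofReal]
  simp_rw [integral_mul_comp_add_eq hψ.integrable hψ.memLp_two]
  rw [integral_const_mul, integral_integral_swap]
  · rw [Complex.ofReal_mul, stableLaplace, ← integral_complex_ofReal]
    push_cast
    congr 2 with x
    have h1 := hW.charFun_increment s t hs hst x
    rw [charFun_apply_real, integral_map hD.aemeasurable (by fun_prop)] at h1
    rw [integral_mul_const, mul_comm]
    congr 1
    push_cast at h1
    exact h1
  · have hg : Integrable (fun p : M × ℝ ↦ ‖fourierHat ψ p.2‖ ^ 2) (Q.prod volume) :=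
      hfi.comp_snd Q
    refine hg.mono' (Measurable.aestronglyMeasurable ?_) (ae_of_all _ fun p ↦ ?_)
    · have h1 : Measurable fun p : M × ℝ ↦ W t p.1 - W s p.1 := hD.comp measurable_fst
      have h2 : Measurable fun p : M × ℝ ↦ fourierHat ψ p.2 := hfm.comp measurable_snd
      simp only [Function.uncurry_def]
      fun_prop
    · simp only [Function.uncurry_def]
      rw [norm_mul, Complex.norm_exp_ofReal_mul_I, one_mul, Complex.norm_real, norm_pow, norm_norm]

theorem integral_sq_occupationTime (hW : IsStableFlow α W Q) (hψ : IsGaussianDominated C ψ)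
    (T : ℝ) :
    ∫ p, occupationTime W ψ T p ^ 2 ∂((volume : Measure ℝ).prod Q) =
      ∫ s in Set.Ioc 0 T, ∫ r in Set.Ioc 0 T,
        (2 * Real.pi)⁻¹ * stableLaplace α (fun x ↦ ‖fourierHat ψ x‖ ^ 2) |r - s| := by
  set l : Measure ℝ := volume.restrict (Set.Ioc 0 T) with hl
  have h1 : ∀ p, occupationTime W ψ T p ^ 2 =
      ∫ q, ψ (p.1 + W q.1 p.2) * ψ (p.1 + W q.2 p.2) ∂(l.prod l) := fun p ↦ by
    rw [integral_prod_mul (fun s ↦ ψ (p.1 + W s p.2)) (fun s ↦ ψ (p.1 + W s p.2)), ← sq]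
    rfl
  have hm : Measurable (fun v : (ℝ × M) × (ℝ × ℝ) ↦
      ψ (v.1.1 + W v.2.1 v.1.2) * ψ (v.1.1 + W v.2.2 v.1.2)) := by
    have h := measurable_comp_flow hW.measurable hψ.measurable
    exact (h.comp (measurable_fst.prodMk measurable_snd.fst)).mul
      (h.comp (measurable_fst.prodMk measurable_snd.snd))
  have hb : ∀ q : ℝ × ℝ, Integrable (fun p : ℝ × M ↦ ψ (p.1 + W q.1 p.2) * ψ (p.1 + W q.2 p.2))
      ((volume : Measure ℝ).prod Q) := fun q ↦ by
    refine (integrable_comp_flow hW.measurable hψ.integrable q.2).bdd_mul (c := C) ?_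
      (ae_of_all _ fun p ↦ hψ.abs_le _)
    exact ((measurable_comp_flow hW.measurable hψ.measurable).comp
      measurable_prodMk_right).aestronglyMeasurable
  have hi : Integrable (fun v : (ℝ × M) × (ℝ × ℝ) ↦
      ψ (v.1.1 + W v.2.1 v.1.2) * ψ (v.1.1 + W v.2.2 v.1.2))
      (((volume : Measure ℝ).prod Q).prod (l.prod l)) := by
    refine (integrable_prod_iff' hm.aestronglyMeasurable).2 ⟨ae_of_all _ hb, ?_⟩
    refine Integrable.of_bound hm.norm.stronglyMeasurable.integral_prod_left'.aestronglyMeasurable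
      (C * ∫ y, |ψ y|) (ae_of_all _ fun q ↦ ?_)
    rw [Real.norm_eq_abs, abs_of_nonneg (integral_nonneg fun _ ↦ norm_nonneg _),
      ← integral_comp_flow (Q := Q) hW.measurable hψ.measurable.abs q.2, ← integral_const_mul]
    refine integral_mono (hb q).norm
      ((integrable_comp_flow hW.measurable hψ.integrable.abs q.2).const_mul C) fun p ↦ ?_
    simp only [norm_mul, Real.norm_eq_abs]
    exact mul_le_mul_of_nonneg_right (hψ.abs_le _) (abs_nonneg _)
  simp_rw [h1]
  rw [integral_integral_swap hi, integral_prod _ hi.integral_prod_right]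
  refine setIntegral_congr_fun measurableSet_Ioc fun s hs ↦
    setIntegral_congr_fun measurableSet_Ioc fun r hr ↦ ?_
  rcases le_total s r with h | h
  · simp only
    rw [integral_mul_comp_flow hW hψ hs.1.le h, abs_of_nonneg (sub_nonneg.2 h)]
  · simp only
    rw [abs_sub_comm, abs_of_nonneg (sub_nonneg.2 h), ← integral_mul_comp_flow hW hψ hr.1.le h]
    congr 1 with p
    ring

/-- The occupation times have asymptotically linear second moments. -/
theorem tendsto_integral_sq_occupationTime (hα0 : 0 < α) (hα1 : α < 1) (hW : IsStableFlow α W Q)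
    (hψ : IsGaussianDominated C ψ) :
    Tendsto (fun T : ℝ ↦ (1 / T) * ∫ p, occupationTime W ψ T p ^ 2 ∂((volume : Measure ℝ).prod Q))
      atTop (𝓝 (Real.pi⁻¹ * ∫ x, ‖fourierHat ψ x‖ ^ 2 * (1 / |x| ^ α))) := by
  have hint := integrable_norm_sq_fourierHat_div hα0 hα1 hψ.integrable hψ.memLp_two
  have hfm : Measurable fun x ↦ ‖fourierHat ψ x‖ ^ 2 := by
    have := (continuous_fourierHat hψ.integrable).measurable
    fun_prop
  have h0 : ∀ x, 0 ≤ ‖fourierHat ψ x‖ ^ 2 := fun x ↦ by positivity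
  have h := tendsto_average_correlation
    (k := fun u ↦ (2 * Real.pi)⁻¹ * stableLaplace α (fun x ↦ ‖fourierHat ψ x‖ ^ 2) u)
    ((integrableOn_stableLaplace h0 hfm hint).const_mul _)
  rw [integral_const_mul, integral_stableLaplace h0 hfm hint] at h
  simp_rw [integral_sq_occupationTime hW hψ]
  refine h.trans (le_of_eq ?_)
  congr 1
  have := Real.pi_ne_zero
  field_simp

end Moments

/-! ### Third moments of occupation times -/

/-- The Gaussian function `exp (-y² / 2)`, with values in `[0, ∞]`. -/
noncomputable def gaussianBump (y : ℝ) : ℝ≥0∞ := ENNReal.ofReal (Real.exp (-(y ^ 2 / 2)))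

theorem measurable_gaussianBump : Measurable gaussianBump := by
  unfold gaussianBump
  fun_prop

theorem lintegral_gaussianBump_ne_top : ∫⁻ y, gaussianBump y ≠ ∞ := by
  have h := (integrable_exp_neg_mul_sq (b := 1 / 2) (by norm_num)).lintegral_lt_top
  refine (lt_of_le_of_lt (le_of_eq ?_) h).ne
  refine lintegral_congr fun y ↦ ?_
  rw [gaussianBump]
  congr 2
  ring

/-- The mean of `exp (-D² / 2)`, where `D` is an increment of the stable motion over a time `|u|`,
written as an integral against the Gaussian law. By `lintegral_gaussianBump_increment_le` it bounds
the mean of `exp (-(a + D)² / 2)` for every `a`. -/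
noncomputable def gaussianPotential (α u : ℝ) : ℝ≥0∞ :=
  ENNReal.ofReal (stableLaplace α (gaussianPDFReal 0 1) |u|)

theorem integrable_gaussianPDFReal_div {α : ℝ} (hα0 : 0 < α) (hα1 : α < 1) :
    Integrable (fun x ↦ gaussianPDFReal 0 1 x * (1 / |x| ^ α)) := by
  refine integrable_mul_one_div_abs_rpow (K := (√(2 * Real.pi * (1 : ℝ≥0)))⁻¹) hα0 hα1
    (integrable_gaussianPDFReal 0 1) (gaussianPDFReal_nonneg 0 1) fun x ↦ ?_
  rw [gaussianPDFReal]
  refine mul_le_of_le_one_right (by positivity) (Real.exp_le_one_iff.2 ?_)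
  rw [neg_div]
  exact neg_nonpos.2 (by positivity)

theorem measurable_gaussianPotential (α : ℝ) : Measurable (gaussianPotential α) := by
  have h : Measurable (stableLaplace α (gaussianPDFReal 0 1)) := by
    have h2 : Measurable (fun p : ℝ × ℝ ↦
        gaussianPDFReal 0 1 p.2 * Real.exp (-(p.1 * |p.2| ^ α))) := by
      have := measurable_gaussianPDFReal 0 1
      fun_prop
    exact h2.stronglyMeasurable.integral_prod_right.measurable
  exact (h.comp measurable_id.abs).ennreal_ofReal

theorem lintegral_gaussianPotential_ne_top {α : ℝ} (hα0 : 0 < α) (hα1 : α < 1) :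
    ∫⁻ u, gaussianPotential α u ≠ ∞ := by
  have h1 := integrableOn_stableLaplace (gaussianPDFReal_nonneg 0 1)
    (measurable_gaussianPDFReal 0 1) (integrable_gaussianPDFReal_div hα0 hα1)
  have hIoi : IntegrableOn (fun u ↦ stableLaplace α (gaussianPDFReal 0 1) |u|) (Set.Ioi 0) := by
    refine h1.congr_fun (fun u hu ↦ ?_) measurableSet_Ioi
    rw [abs_of_pos hu]
  have hIic : IntegrableOn (fun u ↦ stableLaplace α (gaussianPDFReal 0 1) |u|) (Set.Iic 0) := by
    have m : MeasurableEmbedding fun x : ℝ ↦ -x := (Homeomorph.neg ℝ).measurableEmbedding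
    rw [← Measure.map_neg_eq_self (volume : Measure ℝ)]
    refine m.integrableOn_map_iff.2 ?_
    simpa [Function.comp_def, integrableOn_Ici_iff_integrableOn_Ioi] using hIoi
  have h2 : Integrable (fun u ↦ stableLaplace α (gaussianPDFReal 0 1) |u|) := by
    rw [← integrableOn_univ, ← Set.Iic_union_Ioi (a := (0 : ℝ))]
    exact hIic.union hIoi
  exact h2.lintegral_lt_top.ne

section Moments

variable {M : Type*} [MeasurableSpace M] {Q : Measure M} [IsProbabilityMeasure Q]
  {W : ℝ → M → ℝ} {α C : ℝ} {ψ : ℝ → ℝ}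

theorem lintegral_gaussianBump_increment_le (hW : IsStableFlow α W Q) {r s : ℝ} (hr : 0 ≤ r)
    (hrs : r ≤ s) (a : ℝ) :
    ∫⁻ z, gaussianBump (a + (W s z - W r z)) ∂Q ≤ gaussianPotential α (s - r) := by
  have hm : ∀ u, Measurable (W u) := fun u ↦ hW.measurable.comp measurable_prodMk_left
  have hD : Measurable fun z ↦ W s z - W r z := (hm s).sub (hm r)
  have hint : Integrable (fun z ↦ Real.exp (-((a + (W s z - W r z)) ^ 2 / 2))) Q := by
    refine Integrable.of_bound (by fun_prop) 1 (ae_of_all _ fun z ↦ ?_)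
    rw [Real.norm_eq_abs, Real.abs_exp]
    exact Real.exp_le_one_iff.2 (neg_nonpos.2 (by positivity))
  unfold gaussianBump gaussianPotential
  rw [← ofReal_integral_eq_lintegral_ofReal hint (ae_of_all _ fun z ↦ (Real.exp_pos _).le),
    abs_of_nonneg (sub_nonneg.2 hrs)]
  refine ENNReal.ofReal_le_ofReal ((le_abs_self _).trans ?_)
  rw [← Real.norm_eq_abs, ← Complex.norm_real, ← integral_complex_ofReal]
  -- The Gaussian function is the characteristic function of the standard Gaussian law.
  have h1 : ∀ y : ℝ, ((Real.exp (-(y ^ 2 / 2)) : ℝ) : ℂ) =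
      ∫ x, Complex.exp ((y : ℂ) * x * Complex.I) ∂(gaussianReal 0 1) := fun y ↦ by
    have h := charFun_gaussianReal (μ := 0) (v := 1) y
    rw [charFun_apply_real] at h
    rw [h]
    push_cast
    congr 1
    ring
  simp_rw [h1]
  have hi : Integrable (Function.uncurry fun (z : M) (x : ℝ) ↦
      Complex.exp (((a + (W s z - W r z) : ℝ) : ℂ) * x * Complex.I))
      (Q.prod (gaussianReal 0 1)) := by
    refine Integrable.of_bound (C := 1) (Measurable.aestronglyMeasurable ?_)
      (ae_of_all _ fun p ↦ ?_)
    · have h2 : Measurable fun p : M × ℝ ↦ W s p.1 - W r p.1 := hD.comp measurable_fst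
      simp only [Function.uncurry_def]
      fun_prop
    · simp only [Function.uncurry_def]
      rw [← Complex.ofReal_mul, Complex.norm_exp_ofReal_mul_I]
  rw [integral_integral_swap hi]
  have h2 : ∀ x : ℝ, ∫ z, Complex.exp (((a + (W s z - W r z) : ℝ) : ℂ) * x * Complex.I) ∂Q =
      Complex.exp ((a * x : ℝ) * Complex.I) * ((Real.exp (-((s - r) * |x| ^ α)) : ℝ) : ℂ) := by
    intro x
    have h := hW.charFun_increment r s hr hrs x
    rw [charFun_apply_real, integral_map hD.aemeasurable (by fun_prop)] at h
    rw [Complex.ofReal_exp, ← h, ← integral_const_mul]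
    refine integral_congr_ae (ae_of_all _ fun z ↦ ?_)
    simp only
    rw [← Complex.exp_add]
    push_cast
    congr 1
    ring
  simp_rw [h2]
  refine (norm_integral_le_integral_norm _).trans (le_of_eq ?_)
  rw [integral_gaussianReal_eq_integral_smul one_ne_zero]
  refine integral_congr_ae (ae_of_all _ fun x ↦ ?_)
  simp only
  rw [norm_mul, Complex.norm_exp_ofReal_mul_I, one_mul, Complex.norm_real, Real.norm_eq_abs,
    Real.abs_exp, smul_eq_mul]

/-- The Markov property bounds the correlation of the Gaussian function along the path at three
ordered times. -/
theorem lintegral_gaussianBump_three_le (hW : IsStableFlow α W Q) {r s t : ℝ} (hr : 0 ≤ r)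
    (hrs : r ≤ s) (hst : s ≤ t) :
    ∫⁻ p : ℝ × M, gaussianBump (p.1 + W r p.2) * gaussianBump (p.1 + W s p.2) *
        gaussianBump (p.1 + W t p.2) ∂((volume : Measure ℝ).prod Q) ≤
      (∫⁻ y, gaussianBump y) * gaussianPotential α (s - r) * gaussianPotential α (t - s) := by
  have hm : ∀ u, Measurable (W u) := fun u ↦ hW.measurable.comp measurable_prodMk_left
  have hb := measurable_gaussianBump
  have hD₁ : Measurable fun z ↦ W s z - W r z := (hm s).sub (hm r)
  have hD₂ : Measurable fun z ↦ W t z - W s z := (hm t).sub (hm s)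
  have hms : ∀ u, Measurable fun p : ℝ × M ↦ gaussianBump (p.1 + W u p.2) := fun u ↦
    hb.comp (measurable_fst.add ((hm u).comp measurable_snd))
  have hprod : Measurable fun p : ℝ × M ↦ gaussianBump (p.1 + W r p.2) *
      gaussianBump (p.1 + W s p.2) * gaussianBump (p.1 + W t p.2) :=
    ((hms r).mul (hms s)).mul (hms t)
  rw [lintegral_prod_symm _ hprod.aemeasurable]
  have h1 : ∀ z, ∫⁻ y, gaussianBump (y + W r z) * gaussianBump (y + W s z) *
        gaussianBump (y + W t z) =
      ∫⁻ y, gaussianBump y * (gaussianBump (y + (W s z - W r z)) *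
        gaussianBump (y + (W s z - W r z) + (W t z - W s z))) := fun z ↦ by
    rw [← lintegral_add_right_eq_self (fun y ↦ gaussianBump y * (gaussianBump (y +
      (W s z - W r z)) * gaussianBump (y + (W s z - W r z) + (W t z - W s z)))) (W r z)]
    refine lintegral_congr fun y ↦ ?_
    rw [mul_assoc]
    congr 3 <;> ring_nf
  simp_rw [h1]
  rw [lintegral_lintegral_swap]
  swap
  · refine Measurable.aemeasurable ?_
    have e1 : Measurable fun p : M × ℝ ↦ W s p.1 - W r p.1 := hD₁.comp measurable_fst
    have e2 : Measurable fun p : M × ℝ ↦ W t p.1 - W s p.1 := hD₂.comp measurable_fst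
    simp only [Function.uncurry_def]
    fun_prop
  rw [mul_assoc, ← lintegral_mul_const _ hb]
  refine lintegral_mono fun y ↦ ?_
  rw [lintegral_const_mul _ (by fun_prop)]
  refine mul_le_mul_right ?_ _
  have hind := (indepFun_iff_map_prod_eq_prod_map_map hD₁.aemeasurable hD₂.aemeasurable).1
    (hW.indep_increments r s t hr hrs hst)
  have hF : Measurable fun d : ℝ × ℝ ↦ gaussianBump (y + d.1) * gaussianBump (y + d.1 + d.2) := by
    fun_prop
  have h2 := lintegral_map (μ := Q) hF (hD₁.prodMk hD₂)
  rw [hind, lintegral_prod _ hF.aemeasurable] at h2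
  simp only at h2
  rw [← h2]
  calc ∫⁻ d, ∫⁻ e, gaussianBump (y + d) * gaussianBump (y + d + e)
        ∂(Q.map fun z ↦ W t z - W s z) ∂(Q.map fun z ↦ W s z - W r z)
      ≤ ∫⁻ d, gaussianBump (y + d) * gaussianPotential α (t - s)
          ∂(Q.map fun z ↦ W s z - W r z) := by
        refine lintegral_mono fun d ↦ ?_
        rw [lintegral_const_mul _ (by fun_prop)]
        refine mul_le_mul_right ?_ _
        rw [lintegral_map (by fun_prop) hD₂]
        exact lintegral_gaussianBump_increment_le hW (hr.trans hrs) hst _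
    _ ≤ _ := by
        rw [lintegral_mul_const _ (by fun_prop)]
        refine mul_le_mul_left ?_ _
        rw [lintegral_map (by fun_prop) hD₁]
        exact lintegral_gaussianBump_increment_le hW hr hrs _

theorem gaussianPotential_sub_comm (α s t : ℝ) :
    gaussianPotential α (s - t) = gaussianPotential α (t - s) := by
  rw [gaussianPotential, abs_sub_comm, ← gaussianPotential]

/-- The three times need not be ordered if the bound is summed over the possible middle times. -/
theorem lintegral_gaussianBump_three_le' (hW : IsStableFlow α W Q) {r s t : ℝ} (hr : 0 ≤ r)
    (hs : 0 ≤ s) (ht : 0 ≤ t) :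
    ∫⁻ p : ℝ × M, gaussianBump (p.1 + W r p.2) * gaussianBump (p.1 + W s p.2) *
        gaussianBump (p.1 + W t p.2) ∂((volume : Measure ℝ).prod Q) ≤
      (∫⁻ y, gaussianBump y) * (gaussianPotential α (r - s) * gaussianPotential α (t - s) +
        gaussianPotential α (s - r) * gaussianPotential α (t - r) +
        gaussianPotential α (r - t) * gaussianPotential α (s - t)) := by
  have hK : ∀ {a b c : ℝ}, 0 ≤ a → a ≤ b → b ≤ c →
      ∫⁻ p : ℝ × M, gaussianBump (p.1 + W a p.2) * gaussianBump (p.1 + W b p.2) *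
        gaussianBump (p.1 + W c p.2) ∂((volume : Measure ℝ).prod Q) ≤
      (∫⁻ y, gaussianBump y) * (gaussianPotential α (a - b) * gaussianPotential α (c - b)) :=
    fun ha hab hbc ↦ (lintegral_gaussianBump_three_le hW ha hab hbc).trans
      (le_of_eq (by rw [gaussianPotential_sub_comm, mul_assoc]))
  -- For each of the six orders the middle time selects one of the three summands.
  rw [mul_add, mul_add]
  have i1 : ∀ a b c : ℝ≥0∞, a ≤ a + b + c := fun a b c ↦ le_add_right le_self_add
  have i2 : ∀ a b c : ℝ≥0∞, b ≤ a + b + c := fun a b c ↦ le_add_right le_add_self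
  have i3 : ∀ a b c : ℝ≥0∞, c ≤ a + b + c := fun a b c ↦ le_add_self
  rcases le_total r s with h1 | h1 <;> rcases le_total s t with h2 | h2
  · exact (hK hr h1 h2).trans (i1 _ _ _)
  · rcases le_total r t with h3 | h3
    · refine le_trans (le_of_eq ?_) ((hK hr h3 h2).trans (i3 _ _ _))
      exact lintegral_congr fun p ↦ by ring
    · refine le_trans (le_of_eq ?_) (((hK ht h3 h1).trans (le_of_eq ?_)).trans (i2 _ _ _))
      · exact lintegral_congr fun p ↦ by ring
      · ring
  · rcases le_total r t with h3 | h3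
    · refine le_trans (le_of_eq ?_) ((hK hs h1 h3).trans (i2 _ _ _))
      exact lintegral_congr fun p ↦ by ring
    · refine le_trans (le_of_eq ?_) (((hK hs h2 h3).trans (le_of_eq ?_)).trans (i3 _ _ _))
      · exact lintegral_congr fun p ↦ by ring
      · ring
  · refine le_trans (le_of_eq ?_) (((hK ht h2 h1).trans (le_of_eq ?_)).trans (i1 _ _ _))
    · exact lintegral_congr fun p ↦ by ring
    · ring

/-- The three products of an even kernel along two of the three edges between `r`, `s`, `t` have
small triple integrals: each product leaves one point free, and the other two are integrated out
against the kernel. -/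
theorem lintegral_kernel_three_le {l : Measure ℝ} [IsFiniteMeasure l] {κ : ℝ → ℝ≥0∞}
    (hκ : Measurable κ) (hκs : ∀ s t, κ (s - t) = κ (t - s)) {B : ℝ≥0∞}
    (hB : ∀ s, ∫⁻ r, κ (r - s) ∂l ≤ B) :
    ∫⁻ r, ∫⁻ s, ∫⁻ t, (κ (r - s) * κ (t - s) + κ (s - r) * κ (t - r) + κ (r - t) * κ (s - t))
      ∂l ∂l ∂l ≤ 3 * (B ^ 2 * l Set.univ) := by
  have hone : ∀ r, ∫⁻ s, ∫⁻ t, (κ (r - s) * κ (t - s) + κ (s - r) * κ (t - r) +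
      κ (r - t) * κ (s - t)) ∂l ∂l ≤ 3 * B ^ 2 := by
    intro r
    have hchain : ∫⁻ s, ∫⁻ t, κ (r - s) * κ (t - s) ∂l ∂l ≤ B ^ 2 := by
      calc _ ≤ ∫⁻ s, κ (s - r) * B ∂l := by
            refine lintegral_mono fun s ↦ ?_
            rw [lintegral_const_mul _ (by fun_prop), hκs]
            exact mul_le_mul_right (hB s) _
        _ ≤ _ := by
            rw [lintegral_mul_const _ (by fun_prop), sq]
            exact mul_le_mul_left (hB r) _
    have hstar : ∫⁻ s, ∫⁻ t, κ (s - r) * κ (t - r) ∂l ∂l ≤ B ^ 2 := by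
      calc _ ≤ ∫⁻ s, κ (s - r) * B ∂l := by
            refine lintegral_mono fun s ↦ ?_
            rw [lintegral_const_mul _ (by fun_prop)]
            exact mul_le_mul_right (hB r) _
        _ ≤ _ := by
            rw [lintegral_mul_const _ (by fun_prop), sq]
            exact mul_le_mul_left (hB r) _
    have hchain' : ∫⁻ s, ∫⁻ t, κ (r - t) * κ (s - t) ∂l ∂l ≤ B ^ 2 := by
      rw [lintegral_lintegral_swap (by fun_prop)]
      exact hchain
    have e : ∀ s, ∫⁻ t, (κ (r - s) * κ (t - s) + κ (s - r) * κ (t - r) +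
        κ (r - t) * κ (s - t)) ∂l = ∫⁻ t, κ (r - s) * κ (t - s) ∂l +
        ∫⁻ t, κ (s - r) * κ (t - r) ∂l + ∫⁻ t, κ (r - t) * κ (s - t) ∂l := fun s ↦ by
      rw [lintegral_add_left (by fun_prop), lintegral_add_left (by fun_prop)]
    have m1 : Measurable fun s ↦ ∫⁻ t, κ (r - s) * κ (t - s) ∂l :=
      Measurable.lintegral_prod_right (by fun_prop)
    have m2 : Measurable fun s ↦ ∫⁻ t, κ (s - r) * κ (t - r) ∂l :=
      Measurable.lintegral_prod_right (by fun_prop)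
    have m12 : Measurable fun s ↦ ∫⁻ t, κ (r - s) * κ (t - s) ∂l +
      ∫⁻ t, κ (s - r) * κ (t - r) ∂l := m1.add m2
    simp_rw [e]
    rw [lintegral_add_left m12, lintegral_add_left m1]
    refine (add_le_add (add_le_add hchain hstar) hchain').trans (le_of_eq (by ring))
  refine (lintegral_mono hone).trans (le_of_eq ?_)
  rw [lintegral_const, mul_assoc]

/-- The third power of an integral as a triple integral. -/
theorem lintegral_lintegral_pow_three {X : Type*} [MeasurableSpace X] {μ : Measure X} [SFinite μ]
    {l : Measure ℝ} [SFinite l] {g : X → ℝ → ℝ≥0∞} (hg : Measurable (Function.uncurry g)) :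
    ∫⁻ p, (∫⁻ s, g p s ∂l) ^ 3 ∂μ =
      ∫⁻ r, ∫⁻ s, ∫⁻ t, ∫⁻ p, g p r * g p s * g p t ∂μ ∂l ∂l ∂l := by
  have hgp : ∀ p, Measurable (g p) := fun p ↦ hg.comp measurable_prodMk_left
  have hgs : ∀ s, Measurable (fun p ↦ g p s) := fun s ↦ hg.comp measurable_prodMk_right
  have hG : Measurable fun p ↦ ∫⁻ s, g p s ∂l := hg.lintegral_prod_right
  have h1 : ∀ r s, ∫⁻ t, ∫⁻ p, g p r * g p s * g p t ∂μ ∂l =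
      ∫⁻ p, g p r * g p s * ∫⁻ t, g p t ∂l ∂μ := fun r s ↦ by
    rw [lintegral_lintegral_swap]
    · exact lintegral_congr fun p ↦ lintegral_const_mul _ (hgp p)
    · have h : Measurable fun v : ℝ × X ↦ g v.2 v.1 := hg.comp measurable_swap
      exact ((((hgs r).comp measurable_snd).mul ((hgs s).comp measurable_snd)).mul h).aemeasurable
  have h2 : ∀ r, ∫⁻ s, ∫⁻ p, g p r * g p s * ∫⁻ t, g p t ∂l ∂μ ∂l =
      ∫⁻ p, g p r * ((∫⁻ t, g p t ∂l) * ∫⁻ t, g p t ∂l) ∂μ := fun r ↦ by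
    rw [lintegral_lintegral_swap]
    · refine lintegral_congr fun p ↦ ?_
      simp_rw [mul_assoc]
      rw [lintegral_const_mul _ ((hgp p).mul_const _), lintegral_mul_const _ (hgp p)]
    · have h : Measurable fun v : ℝ × X ↦ g v.2 v.1 := hg.comp measurable_swap
      exact ((((hgs r).comp measurable_snd).mul h).mul (hG.comp measurable_snd)).aemeasurable
  simp_rw [h1, h2]
  rw [lintegral_lintegral_swap]
  · refine lintegral_congr fun p ↦ ?_
    rw [lintegral_mul_const _ (hgp p)]
    ring
  · have h : Measurable fun v : ℝ × X ↦ g v.2 v.1 := hg.comp measurable_swap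
    exact (h.mul ((hG.comp measurable_snd).mul (hG.comp measurable_snd))).aemeasurable

theorem enorm_occupationTime_le (hW : Measurable (fun p : ℝ × M ↦ W p.1 p.2))
    (hψ : IsGaussianDominated C ψ) (T : ℝ) (p : ℝ × M) :
    ‖occupationTime W ψ T p‖ₑ ≤
      ENNReal.ofReal C * ∫⁻ s in Set.Ioc 0 T, gaussianBump (p.1 + W s p.2) := by
  have hg : Measurable fun s ↦ gaussianBump (p.1 + W s p.2) :=
    measurable_gaussianBump.comp ((hW.comp measurable_prodMk_right).const_add p.1)
  refine (enorm_integral_le_lintegral_enorm _).trans ?_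
  rw [← lintegral_const_mul _ hg]
  refine lintegral_mono fun s ↦ ?_
  rw [Real.enorm_eq_ofReal_abs, gaussianBump, ← ENNReal.ofReal_mul hψ.nonneg]
  exact ENNReal.ofReal_le_ofReal (hψ.bound _)

/-- The third absolute moments of occupation times grow at most linearly. -/
theorem lintegral_enorm_occupationTime_pow_three_le (hW : IsStableFlow α W Q)
    (hψ : IsGaussianDominated C ψ) (T : ℝ) :
    ∫⁻ p, ‖occupationTime W ψ T p‖ₑ ^ 3 ∂((volume : Measure ℝ).prod Q) ≤
      ENNReal.ofReal C ^ 3 * ((∫⁻ y, gaussianBump y) *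
        (3 * ((∫⁻ u, gaussianPotential α u) ^ 2 * ENNReal.ofReal T))) := by
  have hκ := measurable_gaussianPotential α
  have hg : Measurable fun q : (ℝ × M) × ℝ ↦ gaussianBump (q.1.1 + W q.2 q.1.2) :=
    measurable_gaussianBump.comp (measurable_fst.fst.add (hW.measurable.comp
      (measurable_snd.prodMk measurable_fst.snd)))
  have hG : Measurable fun p : ℝ × M ↦ ∫⁻ s in Set.Ioc 0 T, gaussianBump (p.1 + W s p.2) :=
    Measurable.lintegral_prod_right hg
  have hshift : ∀ s, ∫⁻ r in Set.Ioc 0 T, gaussianPotential α (r - s) ≤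
      ∫⁻ u, gaussianPotential α u := fun s ↦
    (setLIntegral_le_lintegral _ _).trans (lintegral_sub_right_eq_self _ s).le
  have hker := lintegral_kernel_three_le (l := volume.restrict (Set.Ioc 0 T)) hκ
    (gaussianPotential_sub_comm α) hshift
  rw [Measure.restrict_apply_univ, Real.volume_Ioc, sub_zero] at hker
  calc ∫⁻ p, ‖occupationTime W ψ T p‖ₑ ^ 3 ∂((volume : Measure ℝ).prod Q)
      ≤ ∫⁻ p, ENNReal.ofReal C ^ 3 * (∫⁻ s in Set.Ioc 0 T, gaussianBump (p.1 + W s p.2)) ^ 3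
          ∂((volume : Measure ℝ).prod Q) := lintegral_mono fun p ↦ by
        rw [← mul_pow]
        exact pow_le_pow_left' (enorm_occupationTime_le hW.measurable hψ T p) 3
    _ = ENNReal.ofReal C ^ 3 * ∫⁻ r in Set.Ioc 0 T, ∫⁻ s in Set.Ioc 0 T, ∫⁻ t in Set.Ioc 0 T,
          ∫⁻ p : ℝ × M, gaussianBump (p.1 + W r p.2) * gaussianBump (p.1 + W s p.2) *
            gaussianBump (p.1 + W t p.2) ∂((volume : Measure ℝ).prod Q) := by
        rw [lintegral_const_mul _ (hG.pow_const 3), lintegral_lintegral_pow_three hg]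
    _ ≤ _ := by
        refine mul_le_mul_right (le_trans ?_ (mul_le_mul_right hker _)) _
        rw [← lintegral_const_mul' _ _ lintegral_gaussianBump_ne_top]
        refine setLIntegral_mono' measurableSet_Ioc fun r hr ↦ ?_
        rw [← lintegral_const_mul' _ _ lintegral_gaussianBump_ne_top]
        refine setLIntegral_mono' measurableSet_Ioc fun s hs ↦ ?_
        rw [← lintegral_const_mul' _ _ lintegral_gaussianBump_ne_top]
        exact setLIntegral_mono' measurableSet_Ioc fun t ht ↦
          lintegral_gaussianBump_three_le' hW hr.1.le hs.1.le ht.1.le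

end Moments

/-! ### The limit of the log-characteristic functions -/

theorem norm_exp_mul_I_sub_quadratic_le (y : ℝ) :
    ‖Complex.exp (y * Complex.I) - 1 - y * Complex.I + ((y ^ 2 / 2 : ℝ) : ℂ)‖ ≤ 4 * |y| ^ 3 := by
  have hI : ‖(y : ℂ) * Complex.I‖ = |y| := by simp
  rcases le_total |y| 1 with h | h
  · have h1 := Complex.norm_exp_sub_sum_le_norm_mul_exp ((y : ℂ) * Complex.I) 3
    have h2 : Complex.exp (y * Complex.I) -
        ∑ m ∈ Finset.range 3, ((y : ℂ) * Complex.I) ^ m / m.factorial =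
        Complex.exp (y * Complex.I) - 1 - y * Complex.I + ((y ^ 2 / 2 : ℝ) : ℂ) := by
      simp only [Finset.sum_range_succ, Finset.sum_range_zero, mul_pow, Complex.I_sq]
      push_cast [Nat.factorial]
      ring
    rw [h2, hI] at h1
    refine h1.trans ?_
    have h3 : Real.exp |y| ≤ 4 :=
      (Real.exp_le_exp.2 h).trans (Real.exp_one_lt_d9.le.trans (by norm_num))
    nlinarith [pow_nonneg (abs_nonneg y) 3]
  · have h1 : ‖Complex.exp (y * Complex.I) - 1‖ ≤ 2 := by
      refine (norm_sub_le _ _).trans ?_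
      rw [Complex.norm_exp_ofReal_mul_I, norm_one]
      norm_num
    have h2 : ‖((y ^ 2 / 2 : ℝ) : ℂ)‖ = |y| ^ 2 / 2 := by
      rw [Complex.norm_real, Real.norm_eq_abs, abs_of_nonneg (by positivity), sq_abs]
    calc _ ≤ 2 + |y| + |y| ^ 2 / 2 := by
          refine (norm_add_le _ _).trans (add_le_add ((norm_sub_le _ _).trans ?_) h2.le)
          exact add_le_add h1 hI.le
      _ ≤ 4 * |y| ^ 3 := by
          have e1 : |y| ≤ |y| ^ 3 := le_self_pow₀ h (by norm_num)
          have e2 : |y| ^ 2 ≤ |y| ^ 3 := pow_le_pow_right₀ h (by norm_num)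
          linarith [one_le_pow₀ h (n := 3)]

section

variable {M : Type*} [MeasurableSpace M] {Q : Measure M} [IsProbabilityMeasure Q]
  {W : ℝ → M → ℝ} {α C : ℝ} {ψ : ℝ → ℝ}

theorem exists_integral_abs_occupationTime_pow_three_le (hα0 : 0 < α) (hα1 : α < 1)
    (hW : IsStableFlow α W Q) (hψ : IsGaussianDominated C ψ) :
    ∃ K : ℝ, ∀ T, 0 ≤ T →
      Integrable (fun p ↦ |occupationTime W ψ T p| ^ 3) ((volume : Measure ℝ).prod Q) ∧
      ∫ p, |occupationTime W ψ T p| ^ 3 ∂((volume : Measure ℝ).prod Q) ≤ K * T := by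
  set K : ℝ≥0∞ := ENNReal.ofReal C ^ 3 * ((∫⁻ y, gaussianBump y) *
    (3 * (∫⁻ u, gaussianPotential α u) ^ 2)) with hK
  have hKt : K ≠ ∞ := by
    have h1 := lintegral_gaussianBump_ne_top
    have h2 := lintegral_gaussianPotential_ne_top hα0 hα1
    exact ENNReal.mul_ne_top (ENNReal.pow_ne_top ENNReal.ofReal_ne_top)
      (ENNReal.mul_ne_top h1 (ENNReal.mul_ne_top (by simp) (ENNReal.pow_ne_top h2)))
  refine ⟨K.toReal, fun T hT ↦ ?_⟩
  have h1 : ∫⁻ p, ‖|occupationTime W ψ T p| ^ 3‖ₑ ∂((volume : Measure ℝ).prod Q) ≤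
      K * ENNReal.ofReal T := by
    simp_rw [enorm_pow, Real.enorm_abs]
    refine (lintegral_enorm_occupationTime_pow_three_le hW hψ T).trans (le_of_eq ?_)
    rw [hK]
    ring
  have h2 : K * ENNReal.ofReal T ≠ ∞ := ENNReal.mul_ne_top hKt ENNReal.ofReal_ne_top
  have hm : Measurable fun p ↦ |occupationTime W ψ T p| ^ 3 :=
    (measurable_occupationTime hW.measurable hψ.measurable T).abs.pow_const 3
  refine ⟨⟨hm.aestronglyMeasurable, h1.trans_lt h2.lt_top⟩, ?_⟩
  have h3 : ∫ p, |occupationTime W ψ T p| ^ 3 ∂((volume : Measure ℝ).prod Q) =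
      ∫ p, ‖|occupationTime W ψ T p| ^ 3‖ ∂((volume : Measure ℝ).prod Q) := by
    simp
  rw [h3, integral_norm_eq_lintegral_enorm hm.aestronglyMeasurable]
  refine (ENNReal.toReal_mono h2 h1).trans (le_of_eq ?_)
  rw [ENNReal.toReal_mul, ENNReal.toReal_ofReal hT]

/-- The exponent in the characteristic function of the normalised fluctuation converges to that of
a centered Gaussian law: the third moments control the error in the second order expansion of the
exponential. -/
theorem tendsto_integral_exp_occupationTime (hα0 : 0 < α) (hα1 : α < 1)
    (hW : IsStableFlow α W Q) (hψ : IsGaussianDominated C ψ) :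
    Tendsto (fun T : ℝ ↦
      ∫ p, (Complex.exp (((1 / √T * occupationTime W ψ T p : ℝ) : ℂ) * Complex.I) - 1)
          ∂((volume : Measure ℝ).prod Q) -
        ((1 / √T * (T * ∫ y, ψ y) : ℝ) : ℂ) * Complex.I) atTop
      (𝓝 (-(((Real.pi⁻¹ * ∫ x, ‖fourierHat ψ x‖ ^ 2 * (1 / |x| ^ α)) / 2 : ℝ) : ℂ))) := by
  obtain ⟨K, hK⟩ := exists_integral_abs_occupationTime_pow_three_le hα0 hα1 hW hψ
  have hlim := ((Complex.continuous_ofReal.tendsto _).comp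
    ((tendsto_integral_sq_occupationTime hα0 hα1 hW hψ).div_const 2)).neg
  simp only [Function.comp_def] at hlim
  have hsmall : Tendsto (fun T : ℝ ↦ 4 * (K * (1 / √T))) atTop (𝓝 0) := by
    have := (tendsto_const_nhds (x := (1 : ℝ))).div_atTop Real.tendsto_sqrt_atTop
    simpa using (this.const_mul K).const_mul 4
  refine tendsto_of_tendsto_of_dist hlim (squeeze_zero' (Eventually.of_forall fun _ ↦ dist_nonneg)
    ?_ hsmall)
  filter_upwards [eventually_gt_atTop 0] with T hT
  obtain ⟨hi3, hb3⟩ := hK T hT.le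
  have hs : 0 < √T := Real.sqrt_pos.2 hT
  have hm := measurable_occupationTime hW.measurable hψ.measurable T
  have hi1 : Integrable (occupationTime W ψ T) ((volume : Measure ℝ).prod Q) :=
    integrable_occupationTime hW.measurable hψ.measurable hψ.integrable T
  have hi2 : Integrable (fun p ↦ occupationTime W ψ T p ^ 2) ((volume : Measure ℝ).prod Q) := by
    refine (hi1.abs.add hi3).mono' (hm.pow_const 2).aestronglyMeasurable (ae_of_all _ fun p ↦ ?_)
    rw [Real.norm_eq_abs, abs_pow, Pi.add_apply]
    have h0 := abs_nonneg (occupationTime W ψ T p)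
    nlinarith [mul_nonneg h0 (sq_nonneg (|occupationTime W ψ T p| - 1))]
  have hie : Integrable (fun p ↦
      Complex.exp (((1 / √T * occupationTime W ψ T p : ℝ) : ℂ) * Complex.I) - 1)
      ((volume : Measure ℝ).prod Q) := by
    refine (hi1.const_mul (1 / √T)).norm.mono' (by fun_prop) (ae_of_all _ fun p ↦ ?_)
    have := norm_exp_mul_I_sub_exp_mul_I_le (1 / √T * occupationTime W ψ T p) 0
    simpa using this
  have hT2 : (1 / √T) ^ 2 = 1 / T := by rw [div_pow, one_pow, Real.sq_sqrt hT.le]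
  have hL : ∫ p, (((1 / √T * occupationTime W ψ T p : ℝ) : ℂ) * Complex.I)
      ∂((volume : Measure ℝ).prod Q) = ((1 / √T * (T * ∫ y, ψ y) : ℝ) : ℂ) * Complex.I := by
    rw [integral_mul_const, integral_complex_ofReal, integral_const_mul,
      integral_occupationTime hW.measurable hψ.measurable hψ.integrable hT.le]
  have hSq : ∫ p, (((1 / √T * occupationTime W ψ T p) ^ 2 / 2 : ℝ) : ℂ)
      ∂((volume : Measure ℝ).prod Q) =
      (((1 / T) * ∫ p, occupationTime W ψ T p ^ 2 ∂((volume : Measure ℝ).prod Q)) / 2 : ℝ) := by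
    rw [integral_complex_ofReal, integral_div]
    simp_rw [mul_pow, hT2]
    rw [integral_const_mul]
  have hiL : Integrable (fun p ↦ ((1 / √T * occupationTime W ψ T p : ℝ) : ℂ) * Complex.I)
      ((volume : Measure ℝ).prod Q) := ((hi1.const_mul _).ofReal).mul_const _
  have hiS : Integrable (fun p ↦ (((1 / √T * occupationTime W ψ T p) ^ 2 / 2 : ℝ) : ℂ))
      ((volume : Measure ℝ).prod Q) := by
    refine Integrable.ofReal ?_
    simp_rw [mul_pow]
    exact (hi2.const_mul _).div_const _
  have hied : Integrable (fun p ↦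
      Complex.exp (((1 / √T * occupationTime W ψ T p : ℝ) : ℂ) * Complex.I) - 1 -
        ((1 / √T * occupationTime W ψ T p : ℝ) : ℂ) * Complex.I) ((volume : Measure ℝ).prod Q) :=
    hie.sub hiL
  rw [← hL, ← hSq, dist_comm, dist_eq_norm, sub_neg_eq_add, ← integral_sub hie hiL,
    ← integral_add hied hiS]
  refine (norm_integral_le_integral_norm _).trans ?_
  calc ∫ p, ‖Complex.exp (((1 / √T * occupationTime W ψ T p : ℝ) : ℂ) * Complex.I) - 1 -
          ((1 / √T * occupationTime W ψ T p : ℝ) : ℂ) * Complex.I +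
          (((1 / √T * occupationTime W ψ T p) ^ 2 / 2 : ℝ) : ℂ)‖ ∂((volume : Measure ℝ).prod Q)
      ≤ ∫ p, 4 * ((1 / √T) ^ 3 * |occupationTime W ψ T p| ^ 3)
          ∂((volume : Measure ℝ).prod Q) := by
        refine integral_mono_of_nonneg (ae_of_all _ fun _ ↦ norm_nonneg _)
          ((hi3.const_mul _).const_mul _) (ae_of_all _ fun p ↦ ?_)
        refine (norm_exp_mul_I_sub_quadratic_le _).trans (le_of_eq ?_)
        rw [abs_mul, mul_pow, abs_of_pos (one_div_pos.2 hs)]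
    _ = 4 * ((1 / √T) ^ 3 * ∫ p, |occupationTime W ψ T p| ^ 3 ∂((volume : Measure ℝ).prod Q)) := by
        rw [integral_const_mul, integral_const_mul]
    _ ≤ 4 * ((1 / √T) ^ 3 * (K * T)) := by gcongr
    -- Here `(1 / √T)³ T = 1 / √T`.
    _ = 4 * (K * (1 / √T)) := by
        rw [pow_succ, hT2]
        field_simp

end

/-! ### Convergence in distribution of random vectors -/

theorem charFun_map_toLp {Ω ι : Type*} [MeasurableSpace Ω] [Fintype ι] {P : Measure Ω}
    {X : Ω → ι → ℝ} (hX : AEMeasurable X P) (t : EuclideanSpace ℝ ι) :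
    charFun (P.map fun ω ↦ (WithLp.toLp 2 (X ω) : EuclideanSpace ℝ ι)) t =
      ∫ ω, Complex.exp ((∑ i, t i * X ω i : ℝ) * Complex.I) ∂P := by
  have hm : AEMeasurable (fun ω ↦ (WithLp.toLp 2 (X ω) : EuclideanSpace ℝ ι)) P := by fun_prop
  rw [charFun_apply, integral_map hm (Continuous.aestronglyMeasurable (by fun_prop))]
  simp [PiLp.inner_apply]

/-- **Lévy's continuity theorem** for random vectors indexed by a finite type, along a filter
indexed by the reals: it suffices that the characteristic functions converge. -/
theorem tendstoInDistribution_of_tendsto_integral_exp {Ω Ω' ι : Type*} [MeasurableSpace Ω]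
    [MeasurableSpace Ω'] [Fintype ι] {P : Measure Ω} [IsProbabilityMeasure P] {P' : Measure Ω'}
    [IsProbabilityMeasure P'] {X : ℝ → Ω → ι → ℝ} {Y : Ω' → ι → ℝ}
    (hX : ∀ T, AEMeasurable (X T) P) (hY : AEMeasurable Y P')
    (h : ∀ a : ι → ℝ, Tendsto
      (fun T ↦ ∫ ω, Complex.exp ((∑ i, a i * X T ω i : ℝ) * Complex.I) ∂P) atTop
      (𝓝 (∫ ω, Complex.exp ((∑ i, a i * Y ω i : ℝ) * Complex.I) ∂P'))) :
    TendstoInDistribution X atTop Y (fun _ ↦ P) P' := by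
  have key : TendstoInDistribution (fun T ω ↦ (WithLp.toLp 2 (X T ω) : EuclideanSpace ℝ ι)) atTop
      (fun ω ↦ WithLp.toLp 2 (Y ω)) (fun _ ↦ P) P' := by
    have hmX : ∀ T, AEMeasurable (fun ω ↦ (WithLp.toLp 2 (X T ω) : EuclideanSpace ℝ ι)) P :=
      fun T ↦ by have := hX T; fun_prop
    have hmY : AEMeasurable (fun ω ↦ (WithLp.toLp 2 (Y ω) : EuclideanSpace ℝ ι)) P' := by
      fun_prop
    refine ⟨hmX, hmY, ?_⟩
    refine Filter.tendsto_of_seq_tendsto fun u hu ↦ ?_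
    refine ProbabilityMeasure.tendsto_of_tendsto_charFun fun t ↦ ?_
    refine Tendsto.congr (fun n ↦ (charFun_map_toLp (hX (u n)) t).symm) ?_
    exact (((h t).comp hu)).trans (le_of_eq (congrArg _ (charFun_map_toLp hY t).symm))
  exact key.continuous_comp (g := WithLp.ofLp) (by fun_prop)

/-! ### Sums over the particles -/

theorem integrable_empiricalMeasure {Ω : Type*} {x : ℕ → Ω → ℝ} {Z : ℕ → ℝ≥0 → Ω → ℝ}
    {ψ : ℝ → ℝ} {s : ℝ≥0} {ω : Ω} (h : Summable fun i ↦ |ψ (x i ω + Z i s ω)|) :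
    Integrable ψ (empiricalMeasure x Z s ω) := by
  refine integrable_sum_measure (fun i ↦ integrable_dirac (by simp)) ?_
  simpa using h

theorem pairing_empiricalMeasure {Ω : Type*} {x : ℕ → Ω → ℝ} {Z : ℕ → ℝ≥0 → Ω → ℝ}
    {ψ : ℝ → ℝ} {s : ℝ} {ω : Ω} (h : Summable fun i ↦ |ψ (x i ω + Z i s.toNNReal ω)|) :
    pairing (empiricalMeasure x Z) ψ s ω = ∑' i, ψ (x i ω + Z i s.toNNReal ω) := by
  have h1 : Integrable ψ (Measure.sum fun i ↦ Measure.dirac (x i ω + Z i s.toNNReal ω)) :=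
    integrable_empiricalMeasure h
  rw [pairing, empiricalMeasure, integral_sum_measure h1]
  simp

theorem occupationTime_sum_mul {M ι : Type*} [MeasurableSpace M] {W : ℝ → M → ℝ}
    (hW : Measurable (fun p : ℝ × M ↦ W p.1 p.2)) (I : Finset ι) {C : ι → ℝ} {ψ : ι → ℝ → ℝ}
    (hψ : ∀ i ∈ I, IsGaussianDominated (C i) (ψ i)) (a : ι → ℝ) (T : ℝ) (p : ℝ × M) :
    occupationTime W (fun y ↦ ∑ i ∈ I, a i * ψ i y) T p =
      ∑ i ∈ I, a i * occupationTime W (ψ i) T p := by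
  unfold occupationTime
  rw [integral_finsetSum]
  · simp_rw [integral_const_mul]
  · refine fun i hi ↦ Integrable.const_mul ?_ _
    have hm : Measurable fun s ↦ ψ i (p.1 + W s p.2) :=
      (measurable_comp_flow hW (hψ i hi).measurable).comp measurable_prodMk_left
    exact Integrable.of_bound hm.aestronglyMeasurable (C i)
      (ae_of_all _ fun s ↦ (hψ i hi).abs_le _)

namespace IsPoissonStableSystem

variable {Ω : Type*} [MeasurableSpace Ω] {P : Measure Ω} [IsProbabilityMeasure P] {α C : ℝ}
  {x : ℕ → Ω → ℝ} {Z : ℕ → ℝ≥0 → Ω → ℝ} {ψ : ℝ → ℝ}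

omit [IsProbabilityMeasure P] in
theorem ae_rightLimit_eq (h : IsPoissonStableSystem α x Z P) :
    ∀ᵐ ω ∂P, ∀ i, ∀ s : ℝ, rightLimit s (fun t ↦ Z i t ω) = Z i s.toNNReal ω :=
  ae_all_iff.2 fun i ↦ (h.stable_motion i).ae_rightLimit_eq

theorem isProbabilityMeasure_path (h : IsPoissonStableSystem α x Z P) :
    IsProbabilityMeasure (P.map (fun ω s ↦ Z 0 s ω)) :=
  h.isMarkedPoisson.isProbabilityMeasure_mark

theorem ae_summable (h : IsPoissonStableSystem α x Z P) (hψ : IsGaussianDominated C ψ) (s : ℝ) :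
    ∀ᵐ ω ∂P, Summable fun i ↦ |ψ (x i ω + Z i s.toNNReal ω)| := by
  have := h.isProbabilityMeasure_path
  have hF : Measurable fun p : ℝ × (ℝ≥0 → ℝ) ↦ ψ (p.1 + rightLimit s p.2) :=
    (measurable_comp_flow measurable_rightLimit hψ.measurable).comp measurable_prodMk_right
  filter_upwards [h.ae_rightLimit_eq, h.isMarkedPoisson.ae_summable_norm hF
    (integrable_comp_flow measurable_rightLimit hψ.integrable s)] with ω h1 h2
  simpa only [h1] using h2

theorem ae_pairing_eq (h : IsPoissonStableSystem α x Z P) (hψ : IsGaussianDominated C ψ) (s : ℝ) :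
    pairing (empiricalMeasure x Z) ψ s =ᵐ[P]
      fun ω ↦ ∑' i, ψ (x i ω + rightLimit s (fun t ↦ Z i t ω)) := by
  filter_upwards [h.ae_rightLimit_eq, h.ae_summable hψ s] with ω h1 h2
  rw [pairing_empiricalMeasure h2]
  simp only [h1]

/-- The mean of the pairing does not depend on time, as Lebesgue measure is invariant for the
motion. -/
theorem integrable_pairing_and_integral_pairing (h : IsPoissonStableSystem α x Z P)
    (hψ : IsGaussianDominated C ψ) (s : ℝ) :
    Integrable (pairing (empiricalMeasure x Z) ψ s) P ∧
      ∫ ω, pairing (empiricalMeasure x Z) ψ s ω ∂P = ∫ y, ψ y := by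
  have := h.isProbabilityMeasure_path
  have hF : Measurable fun p : ℝ × (ℝ≥0 → ℝ) ↦ ψ (p.1 + rightLimit s p.2) :=
    (measurable_comp_flow measurable_rightLimit hψ.measurable).comp measurable_prodMk_right
  have h1 := h.isMarkedPoisson.integrable_tsum_and_integral_tsum hF
    (integrable_comp_flow measurable_rightLimit hψ.integrable s)
  refine ⟨h1.1.congr (h.ae_pairing_eq hψ s).symm, ?_⟩
  rw [integral_congr_ae (h.ae_pairing_eq hψ s), h1.2,
    integral_comp_flow measurable_rightLimit hψ.measurable]

/-- Almost surely, the occupation times of `|ψ|` by the particles up to time `T` are summable. -/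
theorem ae_summable_occupationTime_abs (h : IsPoissonStableSystem α x Z P)
    (hψ : IsGaussianDominated C ψ) (T : ℝ) :
    ∀ᵐ ω ∂P, Summable fun i ↦
      occupationTime rightLimit (fun y ↦ |ψ y|) T (x i ω, fun t ↦ Z i t ω) := by
  have := h.isProbabilityMeasure_path
  filter_upwards [h.isMarkedPoisson.ae_summable_norm
    (measurable_occupationTime measurable_rightLimit hψ.measurable.abs T)
    (integrable_occupationTime measurable_rightLimit hψ.measurable.abs hψ.integrable.abs T)]
    with ω hω
  refine hω.congr fun i ↦ abs_of_nonneg ?_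
  exact integral_nonneg fun s ↦ abs_nonneg _

/-- Almost surely, summation over the particles and integration over time can be interchanged, and
all integrals involved exist. -/
theorem ae_occupation (h : IsPoissonStableSystem α x Z P) (hψ : IsGaussianDominated C ψ) (T : ℝ) :
    ∀ᵐ ω ∂P,
      (∀ᵐ s ∂(volume.restrict (Set.Ioc 0 T)), Integrable ψ (empiricalMeasure x Z s.toNNReal ω)) ∧
      IntegrableOn (fun s ↦ pairing (empiricalMeasure x Z) ψ s ω) (Set.Ioc 0 T) ∧
      (Summable fun i ↦ occupationTime rightLimit ψ T (x i ω, fun t ↦ Z i t ω)) ∧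
      ∫ s in Set.Ioc 0 T, pairing (empiricalMeasure x Z) ψ s ω =
        ∑' i, occupationTime rightLimit ψ T (x i ω, fun t ↦ Z i t ω) := by
  filter_upwards [h.ae_rightLimit_eq, h.ae_summable_occupationTime_abs hψ T] with ω h1 h2
  set F : ℕ → ℝ → ℝ := fun i s ↦ ψ (x i ω + rightLimit s (fun t ↦ Z i t ω)) with hF
  have hFm : ∀ i, Measurable (F i) := fun i ↦
    (measurable_comp_flow measurable_rightLimit hψ.measurable).comp
      (measurable_prodMk_left (x := ((x i ω, fun t ↦ Z i t ω) : ℝ × (ℝ≥0 → ℝ))))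
  have hFi : ∀ i, Integrable (F i) (volume.restrict (Set.Ioc 0 T)) := fun i ↦
    Integrable.of_bound (hFm i).aestronglyMeasurable C (ae_of_all _ fun s ↦ hψ.abs_le _)
  have hsum : Summable fun i ↦ ∫ s in Set.Ioc 0 T, ‖F i s‖ := h2
  have hHas := hasSum_integral_of_summable_integral_norm hFi hsum
  have hfin : ∫⁻ s in Set.Ioc 0 T, ∑' i, ‖F i s‖ₑ ≠ ∞ := by
    rw [lintegral_tsum fun i ↦ (hFm i).enorm.aemeasurable]
    have e : ∀ i, ∫⁻ s in Set.Ioc 0 T, ‖F i s‖ₑ =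
        ENNReal.ofReal (∫ s in Set.Ioc 0 T, ‖F i s‖) := fun i ↦ by
      rw [ofReal_integral_eq_lintegral_ofReal (hFi i).norm (ae_of_all _ fun _ ↦ norm_nonneg _)]
      simp_rw [ofReal_norm]
    simp_rw [e]
    exact hsum.tsum_ofReal_ne_top
  have hae : ∀ᵐ s ∂(volume.restrict (Set.Ioc 0 T)), Summable fun i ↦ |F i s| := by
    filter_upwards [ae_lt_top (Measurable.tsum fun i ↦ (hFm i).enorm) hfin] with s hs
    exact (ENNReal.summable_toReal hs.ne).congr fun i ↦ by simp
  have hpair : ∀ᵐ s ∂(volume.restrict (Set.Ioc 0 T)),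
      ∑' i, F i s = pairing (empiricalMeasure x Z) ψ s ω := by
    filter_upwards [hae] with s hs
    simp only [hF, h1] at hs ⊢
    rw [pairing_empiricalMeasure hs]
  have hTi : Integrable (fun s ↦ ∑' i, F i s) (volume.restrict (Set.Ioc 0 T)) := by
    refine ⟨(Measurable.tsum hFm).aestronglyMeasurable, ?_⟩
    rw [hasFiniteIntegral_iff_enorm]
    exact lt_of_le_of_lt (lintegral_mono fun s ↦ enorm_tsum_le_tsum_enorm) hfin.lt_top
  refine ⟨?_, hTi.congr hpair, hHas.summable, ?_⟩
  · filter_upwards [hae] with s hs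
    simp only [hF, h1] at hs
    exact integrable_empiricalMeasure hs
  · rw [← integral_congr_ae hpair]
    exact hHas.tsum_eq.symm

theorem occupationIntegrable (h : IsPoissonStableSystem α x Z P) (hψ : IsGaussianDominated C ψ) :
    OccupationIntegrable P (empiricalMeasure x Z) ψ := by
  refine ⟨fun s _ ↦ ⟨?_, (h.integrable_pairing_and_integral_pairing hψ s).1⟩, fun R hR ↦ ⟨?_, ?_⟩⟩
  · filter_upwards [h.ae_summable hψ s] with ω hω
    exact integrable_empiricalMeasure hω
  · simp_rw [(h.integrable_pairing_and_integral_pairing hψ _).2]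
    exact intervalIntegrable_const
  · filter_upwards [h.ae_occupation hψ R] with ω hω
    rw [intervalIntegrable_iff_integrableOn_Ioc_of_le hR,
      ← Measure.restrict_congr_set Ioc_ae_eq_Icc]
    exact ⟨hω.1, hω.2.1⟩

/-- The fluctuation is a centered sum over the marked Poisson process of starting points and
paths. -/
theorem ae_occupationFluctuation_eq (h : IsPoissonStableSystem α x Z P)
    (hψ : IsGaussianDominated C ψ) (T : ℝ) :
    occupationFluctuation P (empiricalMeasure x Z) Real.sqrt T 1 ψ =ᵐ[P] fun ω ↦
      (1 / √T) * (∑' i, occupationTime rightLimit ψ T (x i ω, fun t ↦ Z i t ω) - T * ∫ y, ψ y) := by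
  rcases le_or_gt T 0 with hT | hT
  · -- Both sides vanish, since `√T = 0` and the factor `1 / √T` is then zero.
    refine ae_of_all _ fun ω ↦ ?_
    simp [occupationFluctuation, Real.sqrt_eq_zero_of_nonpos hT]
  · filter_upwards [h.ae_occupation hψ T] with ω hω
    rw [occupationFluctuation]
    simp_rw [(h.integrable_pairing_and_integral_pairing hψ _).2]
    rw [mul_one, intervalIntegral.integral_of_le hT.le, hω.2.2.2, intervalIntegral.integral_const]
    simp

theorem aemeasurable_occupationFluctuation (h : IsPoissonStableSystem α x Z P)
    (hψ : IsGaussianDominated C ψ) (T : ℝ) :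
    AEMeasurable (occupationFluctuation P (empiricalMeasure x Z) Real.sqrt T 1 ψ) P := by
  refine AEMeasurable.congr ?_ (h.ae_occupationFluctuation_eq hψ T).symm
  have hm : Measurable fun ω ↦ ∑' i, occupationTime rightLimit ψ T (x i ω, fun t ↦ Z i t ω) :=
    Measurable.tsum fun i ↦
      (measurable_occupationTime measurable_rightLimit hψ.measurable T).comp
        (h.isMarkedPoisson.measurable_point_mark i)
  exact ((hm.sub_const _).const_mul _).aemeasurable

/-- The fluctuation is almost surely linear in the test function. -/
theorem ae_sum_mul_occupationFluctuation {ι : Type*} (h : IsPoissonStableSystem α x Z P)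
    (I : Finset ι) {C : ι → ℝ} {ψ : ι → ℝ → ℝ} (hψ : ∀ i, IsGaussianDominated (C i) (ψ i))
    (a : ι → ℝ) (T : ℝ) :
    (fun ω ↦ ∑ i ∈ I, a i *
      occupationFluctuation P (empiricalMeasure x Z) Real.sqrt T 1 (ψ i) ω) =ᵐ[P]
    occupationFluctuation P (empiricalMeasure x Z) Real.sqrt T 1
      (fun y ↦ ∑ i ∈ I, a i * ψ i y) := by
  have hsum : IsGaussianDominated (∑ i ∈ I, |a i| * C i) (fun y ↦ ∑ i ∈ I, a i * ψ i y) :=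
    IsGaussianDominated.sum I fun i _ ↦ (hψ i).const_mul (a i)
  have e1 : ∀ᵐ ω ∂P, ∀ i ∈ I,
      (Summable fun k ↦ occupationTime rightLimit (ψ i) T (x k ω, fun t ↦ Z k t ω)) ∧
      occupationFluctuation P (empiricalMeasure x Z) Real.sqrt T 1 (ψ i) ω =
      (1 / √T) * (∑' k, occupationTime rightLimit (ψ i) T (x k ω, fun t ↦ Z k t ω) -
        T * ∫ y, ψ i y) := by
    rw [Filter.eventually_all_finset]
    intro i _
    filter_upwards [h.ae_occupation (hψ i) T, h.ae_occupationFluctuation_eq (hψ i) T] with ω h1 h2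
    exact ⟨h1.2.2.1, h2⟩
  filter_upwards [e1, h.ae_occupationFluctuation_eq hsum T] with ω h1 h2
  rw [h2, Finset.sum_congr rfl fun i hi ↦ by rw [(h1 i hi).2]]
  simp_rw [occupationTime_sum_mul measurable_rightLimit I (fun i _ ↦ hψ i) a T]
  rw [Summable.tsum_finsetSum fun i hi ↦ ((h1 i hi).1).mul_left (a i),
    integral_finsetSum _ fun i _ ↦ (hψ i).integrable.const_mul (a i)]
  simp_rw [tsum_mul_left, integral_const_mul]
  rw [Finset.mul_sum, ← Finset.sum_sub_distrib, Finset.mul_sum]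
  exact Finset.sum_congr rfl fun i _ ↦ by ring

/-- The characteristic functions of the fluctuations converge to that of a centered Gaussian
law. -/
theorem tendsto_integral_exp_occupationFluctuation (h : IsPoissonStableSystem α x Z P)
    (hα0 : 0 < α) (hα1 : α < 1) (hψ : IsGaussianDominated C ψ) :
    Tendsto (fun T ↦ ∫ ω, Complex.exp
      ((occupationFluctuation P (empiricalMeasure x Z) Real.sqrt T 1 ψ ω : ℝ) * Complex.I) ∂P) atTop
      (𝓝 (Complex.exp
        (-(((Real.pi⁻¹ * ∫ x, ‖fourierHat ψ x‖ ^ 2 * (1 / |x| ^ α)) / 2 : ℝ) : ℂ)))) := by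
  have := h.isProbabilityMeasure_path
  have hflow := (h.stable_motion 0).isStableFlow
  refine ((Complex.continuous_exp.tendsto _).comp
    (tendsto_integral_exp_occupationTime hα0 hα1 hflow hψ)).congr fun T ↦ ?_
  have hm := (measurable_occupationTime measurable_rightLimit hψ.measurable T).const_mul (1 / √T)
  have hi := (integrable_occupationTime (Q := P.map fun ω s ↦ Z 0 s ω) measurable_rightLimit
    hψ.measurable hψ.integrable T).const_mul (1 / √T)
  have h1 := h.isMarkedPoisson.integral_exp_tsum hm hi
  rw [Function.comp_apply, sub_eq_add_neg, Complex.exp_add, ← h1, ← integral_mul_const]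
  refine integral_congr_ae ?_
  filter_upwards [h.ae_occupationFluctuation_eq hψ T] with ω hω
  rw [hω, ← Complex.exp_add, tsum_mul_left]
  push_cast
  congr 1
  ring

end IsPoissonStableSystem

/-! ### The limit theorem -/

namespace IsPiecewiseContinuousTest

variable {ψ : ℝ → ℝ}

theorem measurable (h : IsPiecewiseContinuousTest ψ) : Measurable ψ := by
  obtain ⟨D, hD, hc⟩ := h.piecewise_continuous
  refine measurable_of_restrict_of_restrict_compl hD.measurableSet ?_ ?_
  · have := hD.to_subtype
    exact measurable_of_countable _
  · refine (continuousOn_iff_continuous_domRestrict.1 fun y hy ↦ ?_).measurable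
    exact (hc y hy).continuousWithinAt

theorem exists_isGaussianDominated (h : IsPiecewiseContinuousTest ψ) :
    ∃ C, IsGaussianDominated C ψ := by
  obtain ⟨C, hC⟩ := h.bounded
  obtain ⟨R, hR⟩ := h.compact_support.isCompact.isBounded.subset_closedBall 0
  -- On the support, contained in `[-R, R]`, one has `exp (R² / 2) exp (-y² / 2) ≥ 1`.
  refine ⟨C * Real.exp (R ^ 2 / 2), h.measurable, fun y ↦ ?_⟩
  by_cases hy : y ∈ tsupport ψ
  · have h1 : |y| ≤ R := by simpa using hR hy
    have h2 : y ^ 2 ≤ R ^ 2 := sq_le_sq' (by linarith [neg_abs_le y]) ((le_abs_self y).trans h1)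
    rw [mul_assoc, ← Real.exp_add]
    exact (hC y).trans (le_mul_of_one_le_right ((abs_nonneg _).trans (hC 0))
      (Real.one_le_exp (by linarith)))
  · rw [image_eq_zero_of_notMem_tsupport hy, abs_zero]
    have := (abs_nonneg _).trans (hC 0)
    positivity

end IsPiecewiseContinuousTest

/-- The covariance of the limit is the real inner product of the spectral functions. -/
theorem inner_toLp_spectralFunction {α : ℝ} {ψ φ : ℝ → ℝ} (hψ : MemLp (spectralFunction α ψ) 2)
    (hφ : MemLp (spectralFunction α φ) 2) (hi : Integrable (covarianceIntegrand α ψ φ)) :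
    ((inner ℝ (hψ.toLp _) (hφ.toLp _) : ℝ) : ℂ) =
      (1 / (Real.pi : ℂ)) * ∫ y, covarianceIntegrand α ψ φ y := by
  rw [← ofReal_integral_re_covariance, L2.inner_def]
  have h1 : ∫ a, inner ℝ (hψ.toLp _ a) (hφ.toLp _ a) =
      ∫ a, Real.pi⁻¹ * (covarianceIntegrand α ψ φ a).re := by
    refine integral_congr_ae ?_
    filter_upwards [hψ.coeFn_toLp, hφ.coeFn_toLp] with y h1 h2
    have h3 := spectralFunction_mul_conj (α := α) ψ φ y
    have h4 := congrArg Complex.re h3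
    rw [← Complex.ofReal_one, ← Complex.ofReal_div, Complex.re_ofReal_mul, one_div] at h4
    rw [h1, h2, real_inner_comm, Complex.inner, h4]
  have h2 : ∫ a, (covarianceIntegrand α ψ φ a).re = (∫ a, covarianceIntegrand α ψ φ a).re :=
    integral_re hi
  rw [h1, integral_const_mul, h2]
  push_cast
  rw [one_div]

/-- The spectral function is linear in the test function, which turns the variance of a linear
combination of the limit variables into that of a single test function. -/
theorem toLp_spectralFunction_sum {ι : Type*} {α : ℝ} (I : Finset ι) (a : ι → ℝ) {ψ : ι → ℝ → ℝ}
    (hi : ∀ i ∈ I, Integrable (ψ i)) (hψ : ∀ i, MemLp (spectralFunction α (ψ i)) 2)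
    (hs : MemLp (spectralFunction α (fun y ↦ ∑ i ∈ I, a i * ψ i y)) 2) :
    ∑ i ∈ I, a i • (hψ i).toLp _ = hs.toLp _ := by
  refine Lp.ext ?_
  have h1 : ∀ᵐ y, ∀ i ∈ I, (a i • (hψ i).toLp _ : Lp ℂ 2 (volume : Measure ℝ)) y =
      a i * spectralFunction α (ψ i) y := by
    rw [Filter.eventually_all_finset]
    intro i _
    filter_upwards [Lp.coeFn_smul (a i) ((hψ i).toLp _), (hψ i).coeFn_toLp] with y h1 h2
    rw [h1, Pi.smul_apply, h2, Complex.real_smul]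
  filter_upwards [Lp.coeFn_finsetSum I (fun i ↦ a i • (hψ i).toLp _), h1, hs.coeFn_toLp]
    with y h1 h2 h3
  rw [h1, Finset.sum_apply, Finset.sum_congr rfl h2, h3, spectralFunction,
    fourierHat_sum_mul I a ψ hi, Finset.mul_sum]
  exact Finset.sum_congr rfl fun i _ ↦ by rw [spectralFunction]; ring

theorem norm_sq_toLp_spectralFunction {α : ℝ} {ψ : ℝ → ℝ} (hψ : MemLp (spectralFunction α ψ) 2)
    (hi : Integrable (covarianceIntegrand α ψ ψ)) :
    ‖hψ.toLp _‖ ^ 2 = Real.pi⁻¹ * ∫ x, ‖fourierHat ψ x‖ ^ 2 * (1 / |x| ^ α) := by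
  apply Complex.ofReal_injective
  rw [← real_inner_self_eq_norm_sq, inner_toLp_spectralFunction hψ hψ hi]
  push_cast
  rw [one_div, ← integral_complex_ofReal]
  congr 2 with x
  rw [covarianceIntegrand, Complex.mul_conj']
  push_cast
  rfl

theorem proposition2p11 {Ω : Type*} [MeasurableSpace Ω] (P : Measure Ω) [IsProbabilityMeasure P]
    (α : ℝ) (hα0 : 0 < α) (hα1 : α < 1)
    (x : ℕ → Ω → ℝ) (Z : ℕ → ℝ≥0 → Ω → ℝ) (hsys : IsPoissonStableSystem α x Z P)
    (ψ : ℝ≥0 → ℝ → ℝ) (hψ : ∀ t, IsPiecewiseContinuousTest (ψ t)) :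
    (∀ t, OccupationIntegrable P (empiricalMeasure x Z) (ψ t)) ∧
    (∀ t s, Integrable (covarianceIntegrand α (ψ t) (ψ s)) (volume : Measure ℝ)) ∧
    ∃ (Ω' : Type) (_ : MeasurableSpace Ω') (P' : Measure Ω') (_ : IsProbabilityMeasure P')
      (ϑ : ℝ≥0 → Ω' → ℝ),
      IsGaussianProcess ϑ P' ∧
      (∀ t, ∫ ω, ϑ t ω ∂P' = 0) ∧
      (∀ t s, ((∫ ω, ϑ t ω * ϑ s ω ∂P' : ℝ) : ℂ) =
        (1 / (Real.pi : ℂ)) * ∫ y : ℝ, covarianceIntegrand α (ψ t) (ψ s) y) ∧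
      FiniteDimTendsto
        (fun T t ↦ occupationFluctuation P (empiricalMeasure x Z) Real.sqrt T 1 (ψ t))
        P ϑ P' := by
  choose C hC using fun t ↦ (hψ t).exists_isGaussianDominated
  have hint : ∀ {C D : ℝ} {f g : ℝ → ℝ}, IsGaussianDominated C f → IsGaussianDominated D g →
      Integrable (covarianceIntegrand α f g) := fun hf hg ↦
    integrable_covarianceIntegrand hα0 hα1 hf.integrable hf.memLp_two hg.integrable hg.memLp_two
  have hmem : ∀ {C : ℝ} {f : ℝ → ℝ}, IsGaussianDominated C f → MemLp (spectralFunction α f) 2 :=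
    fun hf ↦ memLp_spectralFunction hα0 hα1 hf.integrable hf.memLp_two
  refine ⟨fun t ↦ hsys.occupationIntegrable (hC t), fun t s ↦ hint (hC t) (hC s), ?_⟩
  obtain ⟨Ω', mΩ', P', hP', ϑ, hgauss, hmean, hcov, hmeas, hchar⟩ :=
    exists_gaussianProcess fun t : ℝ≥0 ↦ (hmem (hC t)).toLp (spectralFunction α (ψ t))
  refine ⟨Ω', mΩ', P', hP', ϑ, hgauss, hmean, fun t s ↦ ?_, fun I ↦ ?_⟩
  · rw [hcov]
    exact inner_toLp_spectralFunction _ _ (hint (hC t) (hC s))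
  · refine tendstoInDistribution_of_tendsto_integral_exp
      (fun T ↦ aemeasurable_pi_lambda _ fun i ↦ hsys.aemeasurable_occupationFluctuation (hC i) T)
      (aemeasurable_pi_lambda _ fun i ↦ hmeas i) fun a ↦ ?_
    have hsum : IsGaussianDominated (∑ i : I, |a i| * C i) (fun y ↦ ∑ i : I, a i * ψ i y) :=
      IsGaussianDominated.sum Finset.univ fun i _ ↦ (hC i).const_mul (a i)
    have hlim := hsys.tendsto_integral_exp_occupationFluctuation hα0 hα1 hsum
    rw [← norm_sq_toLp_spectralFunction (hmem hsum) (hint hsum hsum),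
      ← toLp_spectralFunction_sum Finset.univ a (fun i _ ↦ (hC i).integrable)
        (fun i : I ↦ hmem (hC i)) (hmem hsum), ← hchar I a] at hlim
    refine hlim.congr fun T ↦ integral_congr_ae ?_
    filter_upwards [hsys.ae_sum_mul_occupationFluctuation Finset.univ (fun i : I ↦ hC i) a T]
      with ω hω
    rw [← hω]
    rfl
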